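/- Let $n \ge 2$ and let $\mathbb{RP}^{n+1} = \mathbb{S}^{n+1}/\{\pm 1\}$ carry the metric of constant sectional curvature $1$ induced from the round unit sphere $\mathbb{S}^{n+1}$, with geodesic distance $d$. Let $M^n$ be a closed (compact, without boundary) and connected smooth hypersurface of $\mathbb{RP}^{n+1}$, possibly only immersed. Suppose that there exist a totally geodesic projective space $\mathbb{RP}^n \subset \mathbb{RP}^{n+1}$ of codimension one and a number $R \in (0, \pi/2)$ such that $$ d(x, \mathbb{RP}^n) \le R \quad \text{for all } x \in M . $$ If the principal curvatures $\lambda_1, \dots, \lambda_n$ of $M$ (which are defined up to a common sign, depending on the choice of a local unit normal) satisfy $$ \inf_{x \in M} |\lambda_i(x)| > \tan\left( \frac{\pi/2 + R}{2} \right) \quad \text{for all } i \in \{1, \dots, n\}, $$ then $M$ is diffeomorphic to $\mathbb{S}^n$ or to $\mathbb{RP}^n$. -/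

import Mathlib

open Set Filter Module InnerProductGeometry
open scoped Manifold ContDiff Topology RealInnerProductSpace

/-- Euclidean space `ℝⁿ`. -/
abbrev Euc (n : ℕ) : Type := EuclideanSpace ℝ (Fin n)

/-- The round unit sphere `Sⁿ` in `ℝⁿ⁺¹`; topology and smooth structure are those of Mathlib. -/
abbrev Sph (n : ℕ) : Type := Metric.sphere (0 : Euc (n + 1)) 1

/-- Real projective space `ℝPⁿ`: the lines through the origin of `ℝⁿ⁺¹`. -/
abbrev RP (n : ℕ) : Type := Projectivization ℝ (Euc (n + 1))

namespace RP

variable {n : ℕ}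

/-! ### The smooth structure of `ℝPⁿ` -/

/-- The quotient topology. -/
instance instTopologicalSpace : TopologicalSpace (RP n) :=
  inferInstanceAs (TopologicalSpace (Quotient (projectivizationSetoid ℝ (Euc (n + 1)))))

theorem continuous_mk' : Continuous (Projectivization.mk' ℝ : {v : Euc (n + 1) // v ≠ 0} → RP n) :=
  continuous_quot_mk

theorem isQuotientMap_mk' :
    Topology.IsQuotientMap (Projectivization.mk' ℝ : {v : Euc (n + 1) // v ≠ 0} → RP n) :=
  isQuotientMap_quot_mk

/-- The domain of the `i`-th affine chart: the lines `[v]` with `v i ≠ 0`. -/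
def affineDomain (i : Fin (n + 1)) : Set (RP n) :=
  {l | Projectivization.lift (fun v : {v : Euc (n + 1) // v ≠ 0} => v.1 i ≠ 0)
    (by
      rintro ⟨a, ha⟩ ⟨b, hb⟩ t rfl
      have ht : t ≠ 0 := by
        rintro rfl
        simp at ha
      simp [ht]) l}

@[simp]
theorem mk_mem_affineDomain (i : Fin (n + 1)) (v : Euc (n + 1)) (hv : v ≠ 0) :
    Projectivization.mk ℝ v hv ∈ affineDomain i ↔ v i ≠ 0 := Iff.rfl

/-- The `i`-th affine coordinates: `[v] ↦ (v j / v i)_{j ≠ i}`. -/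
noncomputable def affineCoord (i : Fin (n + 1)) : RP n → Euc n :=
  Projectivization.lift
    (fun v : {v : Euc (n + 1) // v ≠ 0} => WithLp.toLp 2 fun j => v.1 (i.succAbove j) / v.1 i)
    (by
      rintro ⟨a, ha⟩ ⟨b, hb⟩ t rfl
      have ht : t ≠ 0 := by
        rintro rfl
        simp at ha
      ext j
      simp [mul_div_mul_left _ _ ht])

@[simp]
theorem affineCoord_mk (i : Fin (n + 1)) (v : Euc (n + 1)) (hv : v ≠ 0) :
    affineCoord i (Projectivization.mk ℝ v hv) =
      WithLp.toLp 2 fun j => v (i.succAbove j) / v i := rfl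

/-- The vector with `i`-th coordinate `1` and the other coordinates given by `u`. -/
noncomputable def affineVec (i : Fin (n + 1)) (u : Euc n) : Euc (n + 1) :=
  WithLp.toLp 2 (i.insertNth (1 : ℝ) fun j => u j)

@[simp]
theorem affineVec_same (i : Fin (n + 1)) (u : Euc n) : affineVec i u i = 1 := by
  simp [affineVec]

@[simp]
theorem affineVec_succAbove (i : Fin (n + 1)) (u : Euc n) (j : Fin n) :
    affineVec i u (i.succAbove j) = u j := by
  simp [affineVec]

theorem affineVec_ne_zero (i : Fin (n + 1)) (u : Euc n) : affineVec i u ≠ 0 := by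
  intro h
  simpa using congrArg (fun v : Euc (n + 1) => v i) h

theorem contDiff_affineVec_apply (i k : Fin (n + 1)) {m : ℕ∞ω} :
    ContDiff ℝ m fun u : Euc n => affineVec i u k := by
  rcases Fin.eq_self_or_eq_succAbove i k with rfl | ⟨j, rfl⟩
  · simpa using contDiff_const
  · simp only [affineVec_succAbove]
    fun_prop

theorem continuous_affineVec (i : Fin (n + 1)) :
    Continuous (affineVec i : Euc n → Euc (n + 1)) := by
  refine (PiLp.continuous_toLp 2 _).comp (continuous_pi fun k => ?_)
  exact (contDiff_affineVec_apply (m := 0) i k).continuous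

/-- The `i`-th affine chart of `ℝPⁿ`. -/
noncomputable def affineChart (i : Fin (n + 1)) : OpenPartialHomeomorph (RP n) (Euc n) where
  toFun := affineCoord i
  invFun u := Projectivization.mk ℝ (affineVec i u) (affineVec_ne_zero i u)
  source := affineDomain i
  target := univ
  map_source' _ _ := mem_univ _
  map_target' u _ := by simp
  left_inv' l hl := by
    induction l using Projectivization.ind with
    | h v hv =>
      rw [mk_mem_affineDomain] at hl
      rw [Projectivization.mk_eq_mk_iff']
      refine ⟨(v i)⁻¹, ?_⟩
      ext k
      rcases Fin.eq_self_or_eq_succAbove i k with rfl | ⟨j, rfl⟩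
      · simp [hl]
      · simp [div_eq_inv_mul]
  right_inv' u _ := by
    ext j
    simp
  open_source := by
    rw [← isQuotientMap_mk'.isOpen_preimage]
    have : Continuous fun v : {v : Euc (n + 1) // v ≠ 0} => v.1 i := by fun_prop
    exact isOpen_ne.preimage this
  open_target := isOpen_univ
  continuousOn_toFun := by
    have hopen : IsOpen (affineDomain i : Set (RP n)) := by
      rw [← isQuotientMap_mk'.isOpen_preimage]
      have : Continuous fun v : {v : Euc (n + 1) // v ≠ 0} => v.1 i := by fun_prop
      exact isOpen_ne.preimage this
    rw [isQuotientMap_mk'.continuousOn_isOpen_iff hopen]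
    refine (PiLp.continuous_toLp 2 _).comp_continuousOn (continuousOn_pi.2 fun k => ?_)
    refine ContinuousOn.div (by fun_prop) (by fun_prop) ?_
    intro v hv
    exact hv
  continuousOn_invFun := by
    refine Continuous.continuousOn ?_
    exact continuous_mk'.comp ((continuous_affineVec i).subtype_mk (affineVec_ne_zero i))

theorem exists_mem_affineDomain (l : RP n) : ∃ i, l ∈ affineDomain i := by
  induction l using Projectivization.ind with
  | h v hv =>
    by_contra! h
    refine hv ?_
    ext i
    simpa using h i

/-- The atlas of affine charts. -/
noncomputable instance instChartedSpace : ChartedSpace (Euc n) (RP n) where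
  atlas := range affineChart
  chartAt l := affineChart (exists_mem_affineDomain l).choose
  mem_chart_source l := (exists_mem_affineDomain l).choose_spec
  chart_mem_atlas _ := mem_range_self _

instance instIsManifold (m : ℕ∞ω) : IsManifold (𝓡 n) m (RP n) := by
  refine isManifold_of_contDiffOn _ _ _ ?_
  rintro _ _ ⟨i, rfl⟩ ⟨j, rfl⟩
  have key : ContDiffOn ℝ m
      (fun u : Euc n => (WithLp.toLp 2 fun k => affineVec i u (j.succAbove k) / affineVec i u j :
        Euc n)) {u | affineVec i u j ≠ 0} := by
    rw [contDiffOn_euclidean]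
    intro k
    exact (contDiff_affineVec_apply i _).contDiffOn.div
      (contDiff_affineVec_apply i j).contDiffOn fun u hu => hu
  refine key.mono ?_
  rintro u ⟨⟨-, hu⟩, -⟩
  exact hu

/-! ### The round geometry of `ℝPⁿ`

`ℝPⁿ = Sⁿ / {±1}` carries the metric for which the projection `Sⁿ → ℝPⁿ` is a Riemannian
covering. -/

/-- The geodesic distance of `ℝPⁿ`: the smallest spherical distance (angle) between lifts. -/
noncomputable def geodDist (a b : RP n) : ℝ :=
  min (angle a.rep b.rep) (angle a.rep (-b.rep))

theorem geodDist_mk (v w : Euc (n + 1)) (hv : v ≠ 0) (hw : w ≠ 0) :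
    geodDist (Projectivization.mk ℝ v hv) (Projectivization.mk ℝ w hw) =
      min (angle v w) (angle v (-w)) := by
  obtain ⟨a, ha⟩ := Projectivization.exists_smul_eq_mk_rep ℝ v hv
  obtain ⟨b, hb⟩ := Projectivization.exists_smul_eq_mk_rep ℝ w hw
  rw [geodDist, ← ha, ← hb]
  simp only [Units.smul_def, angle_neg_right]
  rcases lt_or_gt_of_ne a.ne_zero with h1 | h1 <;> rcases lt_or_gt_of_ne b.ne_zero with h2 | h2 <;>
    simp [h1, h2, angle_smul_left_of_neg, angle_smul_right_of_neg, angle_smul_left_of_pos,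
      angle_smul_right_of_pos, angle_neg_left, angle_neg_right] <;>
    exact min_comm _ _

/-- The geodesic distance from a point to a set. -/
noncomputable def geodDistTo (a : RP n) (S : Set (RP n)) : ℝ :=
  sInf (geodDist a '' S)

/-- The projective subspace of the lines contained in the linear subspace `W`. The totally geodesic
`ℝPᵏ ⊆ ℝPⁿ` are these sets, with `W` of dimension `k + 1`. -/
def subspace (W : Submodule ℝ (Euc (n + 1))) : Set (RP n) :=
  {l | l.submodule ≤ W}

end RP

section Hypersurface

variable {n : ℕ} {M : Type*} [TopologicalSpace M] [ChartedSpace (Euc n) M]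

/-- `f : M → ℝPⁿ⁺¹` is a smooth immersion. -/
def IsSmoothImmersion (f : M → RP (n + 1)) : Prop :=
  ContMDiff (𝓡 n) (𝓡 (n + 1)) ∞ f ∧
    ∀ x, Function.Injective (mfderiv (𝓡 n) (𝓡 (n + 1)) f x)

/-- Near `x`, the map `F` is a smooth lift of `f : M → ℝPⁿ⁺¹` to the sphere `Sⁿ⁺¹ ⊆ ℝⁿ⁺²`, and `η` is
a smooth unit normal vector field along `F`, tangent to `Sⁿ⁺¹`. As the projection of the sphere is
a local isometry, `η` represents a unit normal field of `f`. -/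
structure IsLocalUnitNormal (f : M → RP (n + 1)) (x : M) (F η : M → Euc (n + 2)) : Prop where
  contMDiffAt_lift : ContMDiffAt (𝓡 n) 𝓘(ℝ, Euc (n + 2)) ∞ F x
  contMDiffAt_normal : ContMDiffAt (𝓡 n) 𝓘(ℝ, Euc (n + 2)) ∞ η x
  norm_lift : ∀ᶠ y in 𝓝 x, ‖F y‖ = 1
  mk_lift : ∀ᶠ y in 𝓝 x, ∃ h : F y ≠ 0, Projectivization.mk ℝ (F y) h = f y
  norm_normal : ∀ᶠ y in 𝓝 x, ‖η y‖ = 1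
  inner_lift : ∀ᶠ y in 𝓝 x, ⟪η y, F y⟫ = 0
  inner_tangent : ∀ᶠ y in 𝓝 x, ∀ w : TangentSpace (𝓡 n) y,
    ⟪η y, (mfderiv (𝓡 n) 𝓘(ℝ, Euc (n + 2)) F y w : Euc (n + 2))⟫ = 0

/-- `κ` is a principal curvature of `f` at `x`, i.e. an eigenvalue of the shape operator
`A v = - ∇_v η` for one of the two local unit normal fields `η` (so `κ` is determined up to the
choice of `η`, which changes all signs). For `η` as in `IsLocalUnitNormal`, the covariant derivative
`∇_v η` of the sphere is the ordinary derivative `dη v`, because `⟪dη v, F⟫ = - ⟪η, dF v⟫ = 0`. -/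
def IsPrincipalCurvature (f : M → RP (n + 1)) (x : M) (κ : ℝ) : Prop :=
  ∃ F η : M → Euc (n + 2), IsLocalUnitNormal f x F η ∧
    ∃ v : TangentSpace (𝓡 n) x, v ≠ 0 ∧
      -(mfderiv (𝓡 n) 𝓘(ℝ, Euc (n + 2)) η x v : Euc (n + 2)) =
        κ • (mfderiv (𝓡 n) 𝓘(ℝ, Euc (n + 2)) F x v : Euc (n + 2))

end Hypersurface

/-!
The hypersurface is always diffeomorphic to the sphere. Let `p` be a unit normal of the hyperplane
`W` and `s = sin R`, so that every unit lift `v` of a point of `M` satisfies `|⟪v, p⟫| ≤ s`. The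
bound `tan ((π / 2 + R) / 2)` equals `√((1 + s) / (1 - s))`.

*Definiteness.* At a point of `M` of largest distance from the hyperplane, the position vector and
the normal span a plane containing `p`, and comparison with the distance hypersurface bounds all
principal curvatures from below by `-tan R` for one of the normals
(`TubeBound.exists_highest_point`). As no principal curvature lies in `(-c, c)` and `tan R < c`, all
of them are at least `c` there, and by connectedness this holds at every point, for one of the two
normals (`exists_curvatureGE`). The pairs of a lift to the sphere and a normal of this kind form a
two-sheeted family over `M`, the two members at a point being opposite (`positiveLifts`).

*The Gauss map.* Transporting the normal `η` from the lift `F` to `p` along the shortest geodesic of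
the sphere yields the unit vector `η - ⟪η, p⟫ / (1 + ⟪F, p⟫) • (F + p)` of `p^⊥`. A vector in the
kernel of the derivative of this map is a principal vector with principal curvature
`± ⟪η, p⟫ / (1 + ⟪F, p⟫)`, of absolute value at most `√((1 + s) / (1 - s))`. The curvature bound
excludes this, so the Gauss map is a local diffeomorphism to the `n`-sphere
(`TubeBound.isLocalDiffeomorphAt_gaussSphere`).

*Injectivity.* A local homeomorphism from a compact connected Hausdorff space to the sphere of
dimension at least two is a covering, hence injective (`IsLocalHomeomorph.injective_of_sphere`). If
the two-sheeted family were connected, this would apply to the Gauss map on it; but at the highest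
point, where `p` lies in the plane of `F` and `η`, the two members of the family have the same Gauss
image. So the family is disconnected and has a global section
(`IsTwoSheeted.preconnectedSpace_or_exists_section`), that is, `M` has a global lift with a global
normal, and its Gauss map is a diffeomorphism from `M` to the sphere.
-/

/-! ### Local homeomorphisms onto the sphere -/

section SphereCovering

variable {V : Type*} [NormedAddCommGroup V] [InnerProductSpace ℝ V]

/-- The map collapsing the boundary of the closed unit disc of `q^⊥` to the pole `q` and mapping the
interior of the disc homeomorphically onto the rest of the unit sphere. -/
noncomputable def discToSphere (q : V) (u : (ℝ ∙ q)ᗮ) : V :=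
  (2 * √(1 - ‖u‖ ^ 2)) • (u : V) + (2 * ‖u‖ ^ 2 - 1) • q

theorem continuous_discToSphere (q : V) : Continuous (discToSphere q) := by
  unfold discToSphere
  fun_prop

theorem inner_orthogonal_singleton (q : V) (u : (ℝ ∙ q)ᗮ) : ⟪q, (u : V)⟫ = 0 :=
  Submodule.mem_orthogonal_singleton_iff_inner_right.1 u.2

theorem norm_discToSphere {q : V} (hq : ‖q‖ = 1) {u : (ℝ ∙ q)ᗮ} (hu : ‖u‖ ≤ 1) :
    ‖discToSphere q u‖ = 1 := by
  have h0 : ⟪(u : V), q⟫ = 0 := by rw [real_inner_comm]; exact inner_orthogonal_singleton q u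
  have h1 : ‖discToSphere q u‖ ^ 2 = 1 := by
    have hs : √(1 - ‖u‖ ^ 2) ^ 2 = 1 - ‖u‖ ^ 2 := Real.sq_sqrt (by nlinarith [norm_nonneg u])
    rw [discToSphere, norm_add_sq_real, inner_smul_left, inner_smul_right, h0, norm_smul, norm_smul,
      mul_pow, mul_pow, hq, Real.norm_eq_abs, Real.norm_eq_abs, sq_abs, sq_abs, mul_pow, hs,
      Submodule.coe_norm]
    ring
  nlinarith [norm_nonneg (discToSphere q u)]

theorem inner_discToSphere {q : V} (hq : ‖q‖ = 1) (u : (ℝ ∙ q)ᗮ) :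
    ⟪q, discToSphere q u⟫ = 2 * ‖u‖ ^ 2 - 1 := by
  rw [discToSphere, inner_add_right, inner_smul_right, inner_smul_right,
    inner_orthogonal_singleton, real_inner_self_eq_norm_sq, hq]
  ring

/-- Inside the closed disc, the collapsing map identifies nothing but boundary points. -/
theorem discToSphere_eq {q : V} (hq : ‖q‖ = 1) {u w : (ℝ ∙ q)ᗮ} (hu : ‖u‖ ≤ 1)
    (h : discToSphere q u = discToSphere q w) : u = w ∨ (‖u‖ = 1 ∧ ‖w‖ = 1) := by
  have h1 : ‖u‖ ^ 2 = ‖w‖ ^ 2 := by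
    have := congrArg (fun z => ⟪q, z⟫) h
    simp only [inner_discToSphere hq] at this
    linarith
  rcases hu.lt_or_eq with hlt | heq
  · left
    have hpos : 0 < 2 * √(1 - ‖u‖ ^ 2) := by
      have : 0 < 1 - ‖u‖ ^ 2 := by nlinarith [norm_nonneg u]
      positivity
    rw [discToSphere, discToSphere, ← h1, add_left_inj] at h
    exact Subtype.ext (smul_right_injective V hpos.ne' h)
  · right
    refine ⟨heq, ?_⟩
    rw [heq] at h1
    nlinarith [norm_nonneg w]

theorem exists_discToSphere_eq [Nontrivial V] {q : V} (hq : ‖q‖ = 1) (hV : 1 < finrank ℝ V) {y : V}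
    (hy : ‖y‖ = 1) : ∃ u : (ℝ ∙ q)ᗮ, ‖u‖ ≤ 1 ∧ discToSphere q u = y := by
  have : FiniteDimensional ℝ V := FiniteDimensional.of_finrank_pos (by omega)
  have hq0 : q ≠ 0 := by rintro rfl; simp at hq
  obtain ⟨t, ht⟩ : ∃ t, t = ⟪q, y⟫ := ⟨_, rfl⟩
  have habs : |t| ≤ 1 := by
    rw [ht]
    simpa [hq, hy] using abs_real_inner_le_norm q y
  have hz : y - t • q ∈ (ℝ ∙ q)ᗮ := by
    rw [Submodule.mem_orthogonal_singleton_iff_inner_right, inner_sub_right, inner_smul_right,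
      real_inner_self_eq_norm_sq, hq, ht]
    ring
  have hzn : ‖y - t • q‖ ^ 2 = 1 - t ^ 2 := by
    rw [norm_sub_sq_real, inner_smul_right, norm_smul, hq, hy, real_inner_comm, ← ht, mul_pow,
      Real.norm_eq_abs, sq_abs]
    ring
  rcases (abs_le.1 habs).2.lt_or_eq with hlt | heq
  · have h1 : 0 < 2 * (1 - t) := by linarith
    have hr : √(2 * (1 - t)) ^ 2 = 2 * (1 - t) := Real.sq_sqrt h1.le
    have hr0 : 0 < √(2 * (1 - t)) := Real.sqrt_pos.2 h1
    let u : (ℝ ∙ q)ᗮ := (√(2 * (1 - t)))⁻¹ • ⟨y - t • q, hz⟩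
    have hu : ‖u‖ ^ 2 = (1 + t) / 2 := by
      change ‖(√(2 * (1 - t)))⁻¹ • (⟨y - t • q, hz⟩ : (ℝ ∙ q)ᗮ)‖ ^ 2 = _
      rw [norm_smul, mul_pow, Submodule.coe_norm, hzn, norm_inv, inv_pow, Real.norm_eq_abs, sq_abs,
        hr]
      field_simp
      ring
    refine ⟨u, ?_, ?_⟩
    · nlinarith [norm_nonneg u]
    · have h2 : 2 * √(1 - (1 + t) / 2) = √(2 * (1 - t)) := by
        rw [show 2 * (1 - t) = 2 ^ 2 * (1 - (1 + t) / 2) by ring,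
          Real.sqrt_mul (by norm_num), Real.sqrt_sq (by norm_num)]
      rw [discToSphere, hu, h2]
      change √(2 * (1 - t)) • ((√(2 * (1 - t)))⁻¹ • (y - t • q)) + _ = _
      rw [smul_smul, mul_inv_cancel₀ hr0.ne', one_smul,
        show 2 * ((1 + t) / 2) - 1 = t by ring]
      abel
  · have hyq : y = q := by
      rw [heq] at hzn
      have : ‖y - (1 : ℝ) • q‖ = 0 := by nlinarith [norm_nonneg (y - (1 : ℝ) • q)]
      rwa [norm_eq_zero, one_smul, sub_eq_zero] at this
    have : Nontrivial (ℝ ∙ q)ᗮ := by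
      have h := Submodule.finrank_add_finrank_orthogonal (ℝ ∙ q)
      rw [finrank_span_singleton hq0] at h
      exact nontrivial_of_finrank_pos (R := ℝ) (by omega)
    obtain ⟨u, hu⟩ := exists_norm_eq (ℝ ∙ q)ᗮ (zero_le_one (α := ℝ))
    refine ⟨u, hu.le, ?_⟩
    rw [discToSphere, hu, hyq]
    norm_num

/-- A local homeomorphism from a compact connected Hausdorff space to the unit sphere of a space of
dimension at least three is injective: it is a covering map, so that the disc collapsing to the
sphere lifts, and the lift is constant on the boundary of the disc, which is connected. This
produces a section, whose range is open and closed. -/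
theorem IsLocalHomeomorph.injective_of_sphere {X : Type*} [TopologicalSpace X] [CompactSpace X]
    [T2Space X] [PreconnectedSpace X] (hV : 2 < finrank ℝ V) {g : X → Metric.sphere (0 : V) 1}
    (hg : IsLocalHomeomorph g) : Function.Injective g := by
  intro x₀ x₁ hx
  have : FiniteDimensional ℝ V := FiniteDimensional.of_finrank_pos (by omega)
  have : Nontrivial V := nontrivial_of_finrank_pos (R := ℝ) (by omega)
  have hcov : IsCoveringMap g := isLocalHomeomorph_iff_isCoveringMap.1 hg
  -- the pole is antipodal to `g x₀`, so that the centre of the disc is mapped to `g x₀`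
  obtain ⟨q, hqdef⟩ : ∃ q : V, q = -(g x₀ : V) := ⟨_, rfl⟩
  have hq : ‖q‖ = 1 := by rw [hqdef, norm_neg]; exact norm_eq_of_mem_sphere _
  have hq0 : q ≠ 0 := by rintro rfl; simp at hq
  let B : Set (ℝ ∙ q)ᗮ := Metric.closedBall 0 1
  have hB : ∀ u : B, ‖(u : (ℝ ∙ q)ᗮ)‖ ≤ 1 := fun u => mem_closedBall_zero_iff.1 u.2
  have hconv : Convex ℝ B := convex_closedBall 0 1
  have h0B : (0 : (ℝ ∙ q)ᗮ) ∈ B := by simp [B]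
  have : ContractibleSpace B := hconv.contractibleSpace ⟨0, h0B⟩
  have : LocallyPathConnectedSpace B := hconv.locallyPathConnectedSpace
  have : CompactSpace B := isCompact_iff_compactSpace.1 (isCompact_closedBall 0 1)
  have hφmem : ∀ u : B, discToSphere q u ∈ Metric.sphere (0 : V) 1 := fun u => by
    simpa using norm_discToSphere hq (hB u)
  have hφcont : Continuous fun u : B => discToSphere q u :=
    (continuous_discToSphere q).comp continuous_subtype_val
  let φ : C(B, Metric.sphere (0 : V) 1) := ⟨fun u => ⟨discToSphere q u, hφmem u⟩,
    hφcont.subtype_mk hφmem⟩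
  have hφ0 : g x₀ = φ ⟨0, h0B⟩ := by
    ext1
    simp [φ, discToSphere, hqdef]
  obtain ⟨Φ, ⟨hΦ0, hΦ⟩, -⟩ := hcov.existsUnique_continuousMap_lifts φ ⟨0, h0B⟩ x₀ hφ0
  have hφquot : Topology.IsQuotientMap φ := by
    refine φ.continuous.isClosedMap.isQuotientMap φ.continuous ?_
    rintro ⟨y, hy⟩
    obtain ⟨u, hu, huy⟩ := exists_discToSphere_eq hq (by omega) (y := y) (by simpa using hy)
    exact ⟨⟨u, by simpa [B] using hu⟩, Subtype.ext huy⟩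
  have hbdry : ∀ u w : B, ‖(u : (ℝ ∙ q)ᗮ)‖ = 1 → ‖(w : (ℝ ∙ q)ᗮ)‖ = 1 → Φ u = Φ w := by
    have hrank : 1 < Module.rank ℝ (ℝ ∙ q)ᗮ := by
      have h := Submodule.finrank_add_finrank_orthogonal (ℝ ∙ q)
      rw [finrank_span_singleton hq0] at h
      rw [← finrank_eq_rank]
      exact_mod_cast (by omega : 1 < finrank ℝ (ℝ ∙ q)ᗮ)
    have hS := isPreconnected_sphere hrank (0 : (ℝ ∙ q)ᗮ) 1
    have hS' : IsPreconnected (Subtype.val ⁻¹' Metric.sphere (0 : (ℝ ∙ q)ᗮ) 1 : Set B) :=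
      hS.preimage_of_isClosedMap Subtype.val_injective
        (Metric.isClosed_closedBall.isClosedMap_subtype_val)
        (by rw [Subtype.range_coe]; exact Metric.sphere_subset_closedBall)
    intro u w hu hw
    refine hcov.constOn_of_comp hS' Φ.continuous.continuousOn (fun a ha b hb => ?_)
      (by simpa using hu) (by simpa using hw)
    have ha' : ‖(a : (ℝ ∙ q)ᗮ)‖ = 1 := by simpa using ha
    have hb' : ‖(b : (ℝ ∙ q)ᗮ)‖ = 1 := by simpa using hb
    have h1 := congrFun hΦ a
    have h2 := congrFun hΦ b
    simp only [Function.comp_apply] at h1 h2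
    rw [h1, h2]
    ext1
    change discToSphere q a = discToSphere q b
    simp only [discToSphere, ha', hb']
    norm_num
  let σ : C(Metric.sphere (0 : V) 1, X) := hφquot.lift Φ fun u w huw => by
    rcases discToSphere_eq hq (hB u) (congrArg Subtype.val huw) with h | ⟨h1, h2⟩
    · rw [Subtype.ext h]
    · exact hbdry u w h1 h2
  have hσφ : ∀ u, σ (φ u) = Φ u := fun u => by
    have := hφquot.lift_comp Φ fun u w huw => by
      rcases discToSphere_eq hq (hB u) (congrArg Subtype.val huw) with h | ⟨h1, h2⟩
      · rw [Subtype.ext h]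
      · exact hbdry u w h1 h2
    exact DFunLike.congr_fun this u
  have hgσ : ∀ y, g (σ y) = y := fun y => by
    obtain ⟨u, rfl⟩ := hφquot.surjective y
    rw [hσφ]
    exact congrFun hΦ u
  have hopen : IsOpen (range σ) := by
    have hid : g ∘ σ = id := funext hgσ
    exact (hg.isOpenEmbedding_of_comp (hid ▸ Topology.IsOpenEmbedding.id) σ.continuous).isOpen_range
  have huniv : range σ = univ :=
    IsClopen.eq_univ ⟨(isCompact_range σ.continuous).isClosed, hopen⟩ ⟨_, mem_range_self (g x₀)⟩
  obtain ⟨y₀, h₀⟩ : x₀ ∈ range σ := huniv ▸ mem_univ _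
  obtain ⟨y₁, h₁⟩ : x₁ ∈ range σ := huniv ▸ mem_univ _
  rw [← h₀, ← h₁, hgσ, hgσ] at hx
  rw [← h₀, ← h₁, hx]

end SphereCovering

/-! ### Two-sheeted families of points -/

section TwoSheeted

variable {M Z : Type*} [TopologicalSpace M] [TopologicalSpace Z] [Neg Z]

/-- `X ⊆ M × Z` is locally the union of the graphs of two disjoint continuous functions `s` and
`-s`; thus the first projection `X → M` is a covering with two sheets. -/
def IsTwoSheeted (X : Set (M × Z)) : Prop :=
  ∀ x, ∃ U, IsOpen U ∧ x ∈ U ∧ ∃ s : M → Z, ContinuousOn s U ∧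
    ∀ y ∈ U, s y ≠ -s y ∧ ∀ z, (y, z) ∈ X ↔ z = s y ∨ z = -s y

end TwoSheeted

namespace IsTwoSheeted

variable {M Z : Type*} [TopologicalSpace M] [TopologicalSpace Z] [InvolutiveNeg Z] {X : Set (M × Z)}

theorem isClosed [T2Space Z] [ContinuousNeg Z] (hX : IsTwoSheeted X) : IsClosed X := by
  rw [← isOpen_compl_iff, isOpen_iff_mem_nhds]
  rintro ⟨x, z⟩ hxz
  obtain ⟨U, hU, hxU, s, hs, hsX⟩ := hX x
  have hsx : ContinuousAt s x := hs.continuousAt (hU.mem_nhds hxU)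
  have hc : ContinuousAt (fun c : M × Z => s c.1) (x, z) :=
    ContinuousAt.comp (f := Prod.fst) (g := s) hsx continuous_fst.continuousAt
  have h1 : z ≠ s x := fun h => hxz ((hsX x hxU).2 z |>.2 (Or.inl h))
  have h2 : z ≠ -s x := fun h => hxz ((hsX x hxU).2 z |>.2 (Or.inr h))
  have hz : ContinuousAt (fun c : M × Z => c.2) (x, z) := continuous_snd.continuousAt
  filter_upwards [(hz.ne_iff_eventually_ne hc).1 h1, (hz.ne_iff_eventually_ne hc.neg).1 h2,
    continuous_fst.continuousAt.preimage_mem_nhds (hU.mem_nhds hxU)] with c hc1 hc2 hcU hcX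
  rcases (hsX c.1 hcU).2 c.2 |>.1 hcX with h | h
  · exact hc1 h
  · exact hc2 h

/-- The local section can be chosen through any given point. -/
theorem exists_section [ContinuousNeg Z] (hX : IsTwoSheeted X) {c : M × Z} (hc : c ∈ X) :
    ∃ U, IsOpen U ∧ c.1 ∈ U ∧ ∃ s : M → Z, ContinuousOn s U ∧ s c.1 = c.2 ∧
      ∀ y ∈ U, s y ≠ -s y ∧ ∀ z, (y, z) ∈ X ↔ z = s y ∨ z = -s y := by
  obtain ⟨U, hU, hxU, s, hs, hsX⟩ := hX c.1
  rcases ((hsX c.1 hxU).2 c.2).1 hc with h | h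
  · exact ⟨U, hU, hxU, s, hs, h.symm, hsX⟩
  · refine ⟨U, hU, hxU, fun y => -s y, hs.neg, h.symm, fun y hy => ⟨?_, fun z => ?_⟩⟩
    · rw [neg_neg]
      exact ((hsX y hy).1).symm
    · rw [neg_neg, (hsX y hy).2, or_comm]

/-- Near a point of `X` lying on the graph of a local section, `X` is that graph. -/
theorem eventually_snd_eq [T2Space Z] [ContinuousNeg Z] {U : Set M} (hU : IsOpen U) {s : M → Z}
    (hs : ContinuousOn s U)
    (hsX : ∀ y ∈ U, s y ≠ -s y ∧ ∀ z, (y, z) ∈ X ↔ z = s y ∨ z = -s y) {c : X}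
    (hcU : (c : M × Z).1 ∈ U) (hcs : (c : M × Z).2 = s (c : M × Z).1) :
    ∀ᶠ d : X in 𝓝 c, (d : M × Z).1 ∈ U ∧ (d : M × Z).2 = s (d : M × Z).1 := by
  have hfst : Continuous fun c : X => (c : M × Z).1 := continuous_fst.comp continuous_subtype_val
  have hsnd : Continuous fun c : X => (c : M × Z).2 := continuous_snd.comp continuous_subtype_val
  have hcomp : ContinuousOn (fun c : X => s (c : M × Z).1) {c : X | (c : M × Z).1 ∈ U} :=
    hs.comp hfst.continuousOn fun c hc => hc
  have hUX : IsOpen {c : X | (c : M × Z).1 ∈ U} := hU.preimage hfst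
  have hne : (c : M × Z).2 ≠ -s (c : M × Z).1 := by
    rw [hcs]
    exact (hsX _ hcU).1
  filter_upwards [(hsnd.continuousAt.ne_iff_eventually_ne
    (hcomp.continuousAt (hUX.mem_nhds hcU)).neg).1 hne, hUX.mem_nhds hcU] with d hd hdU
  exact ⟨hdU, (((hsX _ hdU).2 _).1 d.2).resolve_right hd⟩

theorem isLocalHomeomorph_fst [T2Space Z] [ContinuousNeg Z] (hX : IsTwoSheeted X) :
    IsLocalHomeomorph fun c : X => (c : M × Z).1 := by
  refine IsLocalHomeomorph.mk _ fun c₀ => ?_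
  obtain ⟨U, hU, hxU, s, hs, hs0, hsX⟩ := hX.exists_section c₀.2
  have hmem : ∀ y ∈ U, (y, s y) ∈ X := fun y hy => ((hsX y hy).2 _).2 (Or.inl rfl)
  have hfst : Continuous fun c : X => (c : M × Z).1 := continuous_fst.comp continuous_subtype_val
  let A : Set X := {c | (c : M × Z).1 ∈ U ∧ (c : M × Z).2 = s (c : M × Z).1}
  have hA : IsOpen A := isOpen_iff_mem_nhds.2 fun c hc =>
    eventually_snd_eq hU hs hsX hc.1 hc.2
  classical
  let e : OpenPartialHomeomorph X M :=
    { toFun := fun c => (c : M × Z).1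
      invFun := fun y => if h : y ∈ U then ⟨(y, s y), hmem y h⟩ else c₀
      source := A
      target := U
      map_source' := fun c hc => hc.1
      map_target' := fun y hy => by
        rw [dif_pos hy]
        exact ⟨hy, rfl⟩
      left_inv' := fun c hc => by
        rw [dif_pos hc.1]
        exact Subtype.ext (Prod.ext rfl hc.2.symm)
      right_inv' := fun y hy => by rw [dif_pos hy]
      open_source := hA
      open_target := hU
      continuousOn_toFun := hfst.continuousOn
      continuousOn_invFun := by
        rw [continuousOn_iff_continuous_domRestrict]
        have : Continuous fun y : U => (⟨((y : M), s y), hmem y y.2⟩ : X) :=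
          (continuous_subtype_val.prodMk
            (continuousOn_iff_continuous_domRestrict.1 hs)).subtype_mk _
        convert this using 2 with y
        simp [Set.domRestrict] }
  exact ⟨e, ⟨hxU, hs0.symm⟩, fun c _ => rfl⟩

/-- Over a connected base, a compact two-sheeted family which is not connected has a global
continuous section: a proper clopen subset meets every fibre in exactly one point. -/
theorem preconnectedSpace_or_exists_section [T2Space Z] [ContinuousNeg Z]
    [PreconnectedSpace M] [T2Space M] [CompactSpace X] (hX : IsTwoSheeted X) :
    PreconnectedSpace X ∨ ∃ σ : M → Z, Continuous σ ∧ ∀ x, (x, σ x) ∈ X := by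
  by_cases hconn : PreconnectedSpace X
  · exact Or.inl hconn
  right
  rw [preconnectedSpace_iff_clopen] at hconn
  push Not at hconn
  obtain ⟨C, hC, hCe, hCu⟩ := hconn
  let π : X → M := fun c => (c : M × Z).1
  have hπ : Continuous π := continuous_fst.comp continuous_subtype_val
  have hπo : IsOpenMap π := hX.isLocalHomeomorph_fst.isOpenMap
  have himg : ∀ D : Set X, IsClopen D → D.Nonempty → π '' D = univ := fun D hD hDne =>
    IsClopen.eq_univ ⟨(hD.isClosed.isCompact.image hπ).isClosed, hπo D hD.isOpen⟩ (hDne.image π)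
  have h1 := himg C hC hCe
  have h2 := himg Cᶜ hC.compl (nonempty_compl.2 hCu)
  have hex : ∀ x, ∃ z, ∃ h : (x, z) ∈ X, (⟨(x, z), h⟩ : X) ∈ C := fun x => by
    obtain ⟨⟨⟨y, z⟩, hc⟩, hcC, rfl⟩ : x ∈ π '' C := h1 ▸ mem_univ x
    exact ⟨z, hc, hcC⟩
  have huniq : ∀ x z z', ∀ h : (x, z) ∈ X, ∀ h' : (x, z') ∈ X, (⟨(x, z), h⟩ : X) ∈ C →
      (⟨(x, z'), h'⟩ : X) ∈ C → z = z' := by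
    intro x z z' h h' hz hz'
    obtain ⟨⟨⟨y, w⟩, hw⟩, hwC, rfl⟩ : x ∈ π '' Cᶜ := h2 ▸ mem_univ x
    obtain ⟨U, -, hyU, s, -, hsX⟩ := hX y
    have e1 := ((hsX y hyU).2 z).1 h
    have e2 := ((hsX y hyU).2 z').1 h'
    have e3 := ((hsX y hyU).2 w).1 hw
    have n1 : w ≠ z := fun e => hwC (by subst e; exact hz)
    have n2 : w ≠ z' := fun e => hwC (by subst e; exact hz')
    grind
  choose σ hσ hσC using hex
  refine ⟨σ, continuous_iff_continuousAt.2 fun x => ?_, hσ⟩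
  obtain ⟨U, hU, hxU, s, hs, hs0, hsX⟩ := hX.exists_section (hσ x)
  have hmem : ∀ y ∈ U, (y, s y) ∈ X := fun y hy => ((hsX y hy).2 _).2 (Or.inl rfl)
  have hcont : Continuous fun y : U => (⟨((y : M), s y), hmem y y.2⟩ : X) :=
    (continuous_subtype_val.prodMk (continuousOn_iff_continuous_domRestrict.1 hs)).subtype_mk _
  have hopen : IsOpen ((fun y : U => (⟨((y : M), s y), hmem y y.2⟩ : X)) ⁻¹' C) :=
    hC.isOpen.preimage hcont
  have hx' : (⟨(x, s x), hmem x hxU⟩ : X) ∈ C := by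
    convert hσC x
  have hev : σ =ᶠ[𝓝 x] s := by
    filter_upwards [(hU.isOpenMap_subtype_val _ hopen).mem_nhds ⟨⟨x, hxU⟩, hx', rfl⟩]
    rintro _ ⟨⟨y, hy⟩, hyC, rfl⟩
    exact huniq y _ _ _ _ (hσC y) hyC
  exact (hs.continuousAt (hU.mem_nhds hxU)).congr hev.symm

end IsTwoSheeted

/-! ### Maps between manifolds of equal dimension -/

section InverseFunction

variable {E : Type*} [NormedAddCommGroup E] [NormedSpace ℝ E]
  {M N : Type*} [TopologicalSpace M] [ChartedSpace E M] [TopologicalSpace N] [ChartedSpace E N]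

/-- The inverse function theorem on manifolds. -/
theorem isLocalDiffeomorphAt_of_injective_mfderiv [FiniteDimensional ℝ E]
    [IsManifold 𝓘(ℝ, E) ∞ M] [IsManifold 𝓘(ℝ, E) ∞ N] {g : M → N} {U : Set M} (hU : IsOpen U)
    (hg : ContMDiffOn 𝓘(ℝ, E) 𝓘(ℝ, E) ∞ g U)
    (hinj : ∀ y ∈ U, Function.Injective (mfderiv 𝓘(ℝ, E) 𝓘(ℝ, E) g y)) {x : M} (hx : x ∈ U) :
    IsLocalDiffeomorphAt 𝓘(ℝ, E) 𝓘(ℝ, E) ∞ g x := by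
  have : CompleteSpace E := FiniteDimensional.complete ℝ E
  let φ := chartAt E x
  let ψ := chartAt E (g x)
  let G : E → E := ψ ∘ g ∘ φ.symm
  let O₁ : Set M := φ.source ∩ (U ∩ g ⁻¹' ψ.source)
  have hO₁ : IsOpen O₁ :=
    φ.open_source.inter (hg.continuousOn.isOpen_inter_preimage hU ψ.open_source)
  let O : Set E := φ.target ∩ φ.symm ⁻¹' O₁
  have hO : IsOpen O := φ.isOpen_inter_preimage_symm hO₁
  have hφ : ContMDiffOn 𝓘(ℝ, E) 𝓘(ℝ, E) ∞ φ φ.source := contMDiffOn_chart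
  have hφs : ContMDiffOn 𝓘(ℝ, E) 𝓘(ℝ, E) ∞ φ.symm φ.target := contMDiffOn_chart_symm
  have hψ : ContMDiffOn 𝓘(ℝ, E) 𝓘(ℝ, E) ∞ ψ ψ.source := contMDiffOn_chart
  have hGm : ContMDiffOn 𝓘(ℝ, E) 𝓘(ℝ, E) ∞ G O :=
    hψ.comp (hg.comp (hφs.mono inter_subset_left) fun u hu => hu.2.2.1) fun u hu => hu.2.2.2
  have hG : ContDiffOn ℝ ∞ G O := contMDiffOn_iff_contDiffOn.1 hGm
  have hdG : ∀ u ∈ O, Function.Injective (fderiv ℝ G u) := by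
    intro u hu
    have h1 : MDifferentiableAt 𝓘(ℝ, E) 𝓘(ℝ, E) φ.symm u :=
      (hφs.contMDiffAt (φ.open_target.mem_nhds hu.1)).mdifferentiableAt (by simp)
    have h2 : MDifferentiableAt 𝓘(ℝ, E) 𝓘(ℝ, E) g (φ.symm u) :=
      (hg.contMDiffAt (hU.mem_nhds hu.2.2.1)).mdifferentiableAt (by simp)
    have h3 : MDifferentiableAt 𝓘(ℝ, E) 𝓘(ℝ, E) ψ (g (φ.symm u)) :=
      (hψ.contMDiffAt (ψ.open_source.mem_nhds hu.2.2.2)).mdifferentiableAt (by simp)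
    have h4 : mfderiv 𝓘(ℝ, E) 𝓘(ℝ, E) G u = (mfderiv 𝓘(ℝ, E) 𝓘(ℝ, E) ψ (g (φ.symm u))).comp
        ((mfderiv 𝓘(ℝ, E) 𝓘(ℝ, E) g (φ.symm u)).comp (mfderiv 𝓘(ℝ, E) 𝓘(ℝ, E) φ.symm u)) := by
      rw [← mfderiv_comp u h2 h1]
      exact mfderiv_comp u h3 (h2.comp u h1)
    rw [← mfderiv_eq_fderiv, h4]
    have hψm : ψ.MDifferentiable 𝓘(ℝ, E) 𝓘(ℝ, E) := mdifferentiable_chart _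
    have hφm : φ.MDifferentiable 𝓘(ℝ, E) 𝓘(ℝ, E) := mdifferentiable_chart _
    exact (hψm.mfderiv_injective hu.2.2.2).comp
      ((hinj _ hu.2.2.1).comp (hφm.symm.mfderiv_injective hu.1))
  have hequiv : ∀ u ∈ O, ∃ A : E ≃L[ℝ] E, HasFDerivAt G (A : E →L[ℝ] E) u := by
    intro u hu
    have hd : DifferentiableAt ℝ G u :=
      (hG.contDiffAt (hO.mem_nhds hu)).differentiableAt (by simp)
    refine ⟨(LinearEquiv.ofInjectiveEndo (fderiv ℝ G u : E →ₗ[ℝ] E)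
      (hdG u hu)).toContinuousLinearEquiv, ?_⟩
    convert hd.hasFDerivAt
    ext v
    rfl
  have hxφ : x ∈ φ.source := mem_chart_source E x
  have hxO : φ x ∈ O := by
    refine ⟨φ.map_source hxφ, ?_⟩
    change φ.symm (φ x) ∈ O₁
    rw [φ.left_inv hxφ]
    exact ⟨hxφ, hx, mem_chart_source E (g x)⟩
  obtain ⟨A, hA⟩ := hequiv _ hxO
  let h := (hG.contDiffAt (hO.mem_nhds hxO)).toOpenPartialHomeomorph G hA (by simp)
  let h' := h.restrOpen O hO
  have hh's : ContDiffOn ℝ ∞ h'.symm h'.target := by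
    intro w hw
    have hw' : h'.symm w ∈ O := (h'.map_target hw).2
    obtain ⟨B, hB⟩ := hequiv _ hw'
    exact (h'.contDiffAt_symm hw hB (hG.contDiffAt (hO.mem_nhds hw'))).contDiffWithinAt
  let e := (φ.trans h').trans ψ.symm
  have he : ∀ y ∈ e.source, y ∈ O₁ ∧ e y = g y := by
    intro y hy
    have hy1 : y ∈ φ.source := hy.1.1
    have hy2 : φ y ∈ O := hy.1.2.2
    have hy3 : y ∈ O₁ := by
      have : φ.symm (φ y) ∈ O₁ := hy2.2
      rwa [φ.left_inv hy1] at this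
    refine ⟨hy3, ?_⟩
    change ψ.symm (ψ (g (φ.symm (φ y)))) = g y
    rw [φ.left_inv hy1, ψ.left_inv hy3.2.2]
  refine ⟨{ toPartialEquiv := e.toPartialEquiv
            open_source := e.open_source
            open_target := e.open_target
            contMDiffOn_toFun := ?_
            contMDiffOn_invFun := ?_ }, ?_, fun y hy => ((he y hy).2).symm⟩
  · exact (hg.mono fun y hy => (he y hy).1.2.1).congr fun y hy => (he y hy).2
  · have h1 : ContMDiffOn 𝓘(ℝ, E) 𝓘(ℝ, E) ∞ h'.symm h'.target :=
      contMDiffOn_iff_contDiffOn.2 hh's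
    have h2 : ∀ y ∈ e.target, y ∈ ψ.source ∧ ψ y ∈ h'.target ∧ h'.symm (ψ y) ∈ φ.target := by
      intro y hy
      exact ⟨hy.1, hy.2.1, hy.2.2⟩
    exact hφs.comp (h1.comp (hψ.mono fun y hy => (h2 y hy).1) fun y hy => (h2 y hy).2.1)
      fun y hy => (h2 y hy).2.2
  · refine ⟨⟨hxφ, ?_⟩, ?_⟩
    · exact ⟨ContDiffAt.mem_toOpenPartialHomeomorph_source _ hA (by simp), hxO⟩
    · change ψ (g (φ.symm (φ x))) ∈ ψ.target
      rw [φ.left_inv hxφ]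
      exact ψ.map_source (mem_chart_source E (g x))

end InverseFunction

section Sphere

variable {E : Type*} [NormedAddCommGroup E] [InnerProductSpace ℝ E]
  {F : Type*} [NormedAddCommGroup F] [NormedSpace ℝ F] {H : Type*} [TopologicalSpace H]
  {I : ModelWithCorners ℝ F H} {M : Type*} [TopologicalSpace M] [ChartedSpace H M]

/-- A map to the sphere which is smooth as a map to the ambient space is smooth. -/
theorem contMDiffOn_of_coe_sphere {m : ℕ∞ω} [IsManifold I m M] {n : ℕ}
    [Fact (finrank ℝ E = n + 1)] {g : M → Metric.sphere (0 : E) 1} {U : Set M}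
    (hg : ContMDiffOn I 𝓘(ℝ, E) m (fun x => (g x : E)) U) : ContMDiffOn I (𝓡 n) m g U := by
  rw [contMDiffOn_iff_target]
  refine ⟨continuousOn_iff_continuous_domRestrict.2
    (continuous_induced_rng.2 (continuousOn_iff_continuous_domRestrict.1 hg.continuousOn)), ?_⟩
  intro v
  let L : _ ≃ₗᵢ[ℝ] _ :=
    (OrthonormalBasis.fromOrthogonalSpanSingleton n (ne_zero_of_mem_unit_sphere (-v))).repr
  have h : ContDiffOn ℝ ω _ Set.univ := L.contDiff.contDiffOn
  have H₁ := (h.comp_inter contDiffOn_stereoToFun).contMDiffOn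
  convert! (H₁.of_le le_top).comp' hg using 1
  ext x
  have hgv : (g x : E) = -(v : E) ↔ ⟪(g x : E), -(v : E)⟫ = 1 := by
    have hgx : ‖(g x : E)‖ = 1 := norm_eq_of_mem_sphere _
    rw [inner_eq_one_iff_of_norm_eq_one hgx]
    exact norm_eq_of_mem_sphere (-v)
  simp [chartAt, ChartedSpace.chartAt, Subtype.ext_iff, hgv, real_inner_comm]

end Sphere

/-! ### Quadratic forms -/

section Rayleigh

variable {V E : Type*} [NormedAddCommGroup V] [NormedSpace ℝ V] [NormedAddCommGroup E]
  [InnerProductSpace ℝ E]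

/-- The smallest eigenvalue `m` of the form `-⟪B ·, A ·⟫` with respect to `⟪A ·, A ·⟫`, as the
minimum of the Rayleigh quotient. -/
theorem exists_min_eigenvalue [FiniteDimensional ℝ V] [Nontrivial V] {A B : V →L[ℝ] E}
    (hA : Function.Injective A) (hsymm : ∀ v w, ⟪B v, A w⟫ = ⟪B w, A v⟫) :
    ∃ m : ℝ, ∃ v ≠ 0, (∀ w, ⟪-B v, A w⟫ = m * ⟪A v, A w⟫) ∧
      ∀ w, m * ‖A w‖ ^ 2 ≤ -⟪B w, A w⟫ := by
  have hA0 : ∀ w : V, w ≠ 0 → 0 < ‖A w‖ := fun w hw =>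
    norm_pos_iff.2 fun h => hw (hA (by rw [h, map_zero]))
  have hne : (Metric.sphere (0 : V) 1).Nonempty := NormedSpace.sphere_nonempty.2 zero_le_one
  have hcont : ContinuousOn (fun w => -⟪B w, A w⟫ / ‖A w‖ ^ 2) (Metric.sphere (0 : V) 1) := by
    refine ContinuousOn.div (by fun_prop) (by fun_prop) fun w hw => ?_
    have := hA0 w (ne_zero_of_mem_unit_sphere (⟨w, hw⟩ : Metric.sphere (0 : V) 1))
    positivity
  obtain ⟨v, hv, hmin⟩ := (isCompact_sphere (0 : V) 1).exists_isMinOn hne hcont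
  have hv0 : v ≠ 0 := ne_zero_of_mem_unit_sphere (⟨v, hv⟩ : Metric.sphere (0 : V) 1)
  obtain ⟨m, hm⟩ : ∃ m, m = -⟪B v, A v⟫ / ‖A v‖ ^ 2 := ⟨_, rfl⟩
  have hmv : -⟪B v, A v⟫ = m * ‖A v‖ ^ 2 := by
    have := hA0 v hv0
    rw [hm]
    field_simp
  have hlow : ∀ w, m * ‖A w‖ ^ 2 ≤ -⟪B w, A w⟫ := by
    intro w
    rcases eq_or_ne w 0 with rfl | hw
    · simp
    have hwn : 0 < ‖w‖ := norm_pos_iff.2 hw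
    have hmem : ‖w‖⁻¹ • w ∈ Metric.sphere (0 : V) 1 := by
      rw [mem_sphere_zero_iff_norm, norm_smul, norm_inv, norm_norm, inv_mul_cancel₀ hwn.ne']
    have h1 : m ≤ -⟪B (‖w‖⁻¹ • w), A (‖w‖⁻¹ • w)⟫ / ‖A (‖w‖⁻¹ • w)‖ ^ 2 := hm ▸ hmin hmem
    have h2 : -⟪B (‖w‖⁻¹ • w), A (‖w‖⁻¹ • w)⟫ / ‖A (‖w‖⁻¹ • w)‖ ^ 2 =
        -⟪B w, A w⟫ / ‖A w‖ ^ 2 := by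
      rw [map_smul, map_smul, real_inner_smul_left, real_inner_smul_right, norm_smul, norm_inv,
        norm_norm]
      field_simp
    rw [h2, le_div_iff₀ (by have := hA0 w hw; positivity)] at h1
    exact h1
  refine ⟨m, v, hv0, fun w => ?_, hlow⟩
  -- the form `-⟪B ·, A ·⟫ - m ⟪A ·, A ·⟫` is nonnegative and vanishes at `v`
  obtain ⟨k, hk⟩ : ∃ k, k = ⟪-B v, A w⟫ - m * ⟪A v, A w⟫ := ⟨_, rfl⟩
  obtain ⟨Q, hQ⟩ : ∃ Q, Q = -⟪B w, A w⟫ - m * ‖A w‖ ^ 2 := ⟨_, rfl⟩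
  have hquad : ∀ t : ℝ, 0 ≤ 2 * t * k + t ^ 2 * Q := by
    intro t
    have h := hlow (v + t • w)
    simp only [map_add, map_smul, inner_add_left, inner_add_right, real_inner_smul_left,
      real_inner_smul_right, norm_add_sq_real, norm_smul, mul_pow, Real.norm_eq_abs, sq_abs] at h
    rw [hsymm w v] at h
    rw [hk, hQ, inner_neg_left]
    nlinarith
  have hQ0 : 0 ≤ Q := by rw [hQ]; linarith [hlow w]
  have hk0 : k = 0 := by
    have h1 := hquad (-k / (Q + 1))
    have h2 : 2 * (-k / (Q + 1)) * k + (-k / (Q + 1)) ^ 2 * Q =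
        -(k ^ 2 * (Q + 2)) / (Q + 1) ^ 2 := by
      field_simp
      ring
    rw [h2, div_nonneg_iff] at h1
    have h3 : 0 < (Q + 1) ^ 2 := by positivity
    rcases h1 with ⟨h, -⟩ | ⟨-, h⟩
    · nlinarith [sq_nonneg k]
    · linarith
  linarith

/-- Positive definiteness of `-⟪B ·, A ·⟫` is an open condition. -/
theorem eventually_nonneg_form [FiniteDimensional ℝ V] {T : Type*} [TopologicalSpace T]
    {A B : T → V →L[ℝ] E} {t : T} (hA : ContinuousAt A t) (hB : ContinuousAt B t)
    (hinj : Function.Injective (A t)) {c : ℝ} (hc : 0 < c)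
    (hpos : ∀ w, c * ‖A t w‖ ^ 2 ≤ -⟪B t w, A t w⟫) :
    ∀ᶠ s in 𝓝 t, ∀ w, 0 ≤ -⟪B s w, A s w⟫ := by
  have hev : ∀ᶠ s in 𝓝 t, ∀ w ∈ Metric.sphere (0 : V) 1, 0 < -⟪B s w, A s w⟫ := by
    refine (isCompact_sphere (0 : V) 1).eventually_forall_of_forall_eventually fun w hw => ?_
    have hw0 : w ≠ 0 := ne_zero_of_mem_unit_sphere (⟨w, hw⟩ : Metric.sphere (0 : V) 1)
    have hAw : 0 < ‖A t w‖ := norm_pos_iff.2 fun h => hw0 (hinj (by rw [h, map_zero]))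
    have h0 : 0 < -⟪B t w, A t w⟫ := lt_of_lt_of_le (by positivity) (hpos w)
    have hA' : ContinuousAt (fun z : T × V => A z.1 z.2) (t, w) :=
      (hA.comp (f := Prod.fst) (x := (t, w)) continuousAt_fst).clm_apply continuousAt_snd
    have hB' : ContinuousAt (fun z : T × V => B z.1 z.2) (t, w) :=
      (hB.comp (f := Prod.fst) (x := (t, w)) continuousAt_fst).clm_apply continuousAt_snd
    have hcont : ContinuousAt (fun z : T × V => -⟪B z.1 z.2, A z.1 z.2⟫) (t, w) :=
      (hB'.inner hA').neg
    exact hcont.eventually (lt_mem_nhds h0)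
  filter_upwards [hev] with s hs w
  rcases eq_or_ne w 0 with rfl | hw
  · simp
  have hwn : 0 < ‖w‖ := norm_pos_iff.2 hw
  have hmem : ‖w‖⁻¹ • w ∈ Metric.sphere (0 : V) 1 := by
    rw [mem_sphere_zero_iff_norm, norm_smul, norm_inv, norm_norm, inv_mul_cancel₀ hwn.ne']
  have h1 := hs _ hmem
  rw [map_smul, map_smul, real_inner_smul_left, real_inner_smul_right] at h1
  have h2 : -⟪B s w, A s w⟫ = ‖w‖ * ‖w‖ * -(‖w‖⁻¹ * (‖w‖⁻¹ * ⟪B s w, A s w⟫)) := by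
    field_simp
  rw [h2]
  positivity

end Rayleigh

/-! ### Hypersurfaces of the sphere in coordinates -/

section NormalPair

variable {V E : Type*} [NormedAddCommGroup V] [NormedSpace ℝ V] [NormedAddCommGroup E]
  [InnerProductSpace ℝ E]

/-- Near `u`, the map `F` is a smooth parametrised hypersurface of the unit sphere of `E`, and `η`
is a smooth unit normal field along it, tangent to the sphere. -/
structure IsNormalPair (F η : V → E) (u : V) : Prop where
  contDiffAt_fst : ContDiffAt ℝ ∞ F u
  contDiffAt_snd : ContDiffAt ℝ ∞ η u
  norm_fst : ∀ᶠ v in 𝓝 u, ‖F v‖ = 1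
  norm_snd : ∀ᶠ v in 𝓝 u, ‖η v‖ = 1
  inner_snd_fst : ∀ᶠ v in 𝓝 u, ⟪η v, F v⟫ = 0
  inner_fderiv : ∀ᶠ v in 𝓝 u, ∀ w, ⟪η v, fderiv ℝ F v w⟫ = 0

theorem inner_fderiv_add_eq_zero {a b : V → E} {u : V} (ha : DifferentiableAt ℝ a u)
    (hb : DifferentiableAt ℝ b u) {k : ℝ} (h : ∀ᶠ v in 𝓝 u, ⟪a v, b v⟫ = k) (w : V) :
    ⟪a u, fderiv ℝ b u w⟫ + ⟪fderiv ℝ a u w, b u⟫ = 0 := by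
  have h1 : fderiv ℝ (fun v => ⟪a v, b v⟫) u = 0 := by
    rw [Filter.EventuallyEq.fderiv_eq (f := fun _ => k) h]
    simp
  rw [← fderiv_inner_apply ℝ ha hb, h1]
  rfl

namespace IsNormalPair

variable {F η : V → E} {u : V}

theorem differentiableAt_fst (h : IsNormalPair F η u) : DifferentiableAt ℝ F u :=
  h.contDiffAt_fst.differentiableAt (by simp)

theorem differentiableAt_snd (h : IsNormalPair F η u) : DifferentiableAt ℝ η u :=
  h.contDiffAt_snd.differentiableAt (by simp)

theorem contDiffAt_fderiv_fst (h : IsNormalPair F η u) : ContDiffAt ℝ ∞ (fderiv ℝ F) u :=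
  h.contDiffAt_fst.fderiv_right (by simp)

theorem contDiffAt_fderiv_snd (h : IsNormalPair F η u) : ContDiffAt ℝ ∞ (fderiv ℝ η) u :=
  h.contDiffAt_snd.fderiv_right (by simp)

theorem inner_fderiv_fst_fst (h : IsNormalPair F η u) (w : V) : ⟪fderiv ℝ F u w, F u⟫ = 0 := by
  have h1 := inner_fderiv_add_eq_zero h.differentiableAt_fst h.differentiableAt_fst (k := 1)
    (h.norm_fst.mono fun v hv => by rw [real_inner_self_eq_norm_sq, hv, one_pow]) w
  rw [real_inner_comm] at h1
  linarith

theorem inner_fderiv_snd_snd (h : IsNormalPair F η u) (w : V) : ⟪fderiv ℝ η u w, η u⟫ = 0 := by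
  have h1 := inner_fderiv_add_eq_zero h.differentiableAt_snd h.differentiableAt_snd (k := 1)
    (h.norm_snd.mono fun v hv => by rw [real_inner_self_eq_norm_sq, hv, one_pow]) w
  rw [real_inner_comm] at h1
  linarith

theorem inner_fderiv_fst_snd (h : IsNormalPair F η u) (w : V) : ⟪fderiv ℝ F u w, η u⟫ = 0 := by
  rw [real_inner_comm]
  exact h.inner_fderiv.self_of_nhds w

theorem inner_fderiv_snd_fst (h : IsNormalPair F η u) (w : V) : ⟪fderiv ℝ η u w, F u⟫ = 0 := by
  have h1 := inner_fderiv_add_eq_zero h.differentiableAt_snd h.differentiableAt_fst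
    h.inner_snd_fst w
  have h2 := h.inner_fderiv.self_of_nhds w
  linarith

/-- The second fundamental form, written with the second derivative of the parametrisation. -/
theorem inner_fderiv_fderiv (h : IsNormalPair F η u) (v w : V) :
    ⟪η u, fderiv ℝ (fderiv ℝ F) u v w⟫ = -⟪fderiv ℝ η u v, fderiv ℝ F u w⟫ := by
  have hd : DifferentiableAt ℝ (fderiv ℝ F) u := h.contDiffAt_fderiv_fst.differentiableAt (by simp)
  have h1 := inner_fderiv_add_eq_zero (b := fun z => fderiv ℝ F z w) h.differentiableAt_snd
    (hd.clm_apply (differentiableAt_const w)) (h.inner_fderiv.mono fun z hz => hz w) v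
  have h2 : fderiv ℝ (fun z => fderiv ℝ F z w) u v = fderiv ℝ (fderiv ℝ F) u v w := by
    rw [fderiv_clm_apply hd (differentiableAt_const w)]
    simp
  rw [h2] at h1
  linarith

/-- Symmetry of the second fundamental form. -/
theorem inner_fderiv_symm (h : IsNormalPair F η u) (v w : V) :
    ⟪fderiv ℝ η u v, fderiv ℝ F u w⟫ = ⟪fderiv ℝ η u w, fderiv ℝ F u v⟫ := by
  have hs : IsSymmSndFDerivAt ℝ F u := h.contDiffAt_fst.isSymmSndFDerivAt (by
    rw [minSmoothness_of_isRCLikeNormedField]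
    exact WithTop.coe_le_coe.2 (le_top (a := (2 : ℕ∞))))
  have h1 := h.inner_fderiv_fderiv v w
  rw [hs v w, h.inner_fderiv_fderiv w v] at h1
  linarith

/-- A vector orthogonal to the position vector and to the normal is tangent to the hypersurface. -/
theorem exists_fderiv_eq [FiniteDimensional ℝ E] (h : IsNormalPair F η u)
    (hinj : Function.Injective (fderiv ℝ F u)) (hdim : finrank ℝ E = finrank ℝ V + 2) {z : E}
    (hz₁ : ⟪z, F u⟫ = 0) (hz₂ : ⟪z, η u⟫ = 0) : ∃ w, fderiv ℝ F u w = z := by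
  let K : Submodule ℝ E := (Submodule.span ℝ (range ![F u, η u]))ᗮ
  have hmemK : ∀ y : E, y ∈ K ↔ ⟪y, F u⟫ = 0 ∧ ⟪y, η u⟫ = 0 := by
    intro y
    rw [Submodule.mem_orthogonal']
    constructor
    · intro hy
      exact ⟨hy _ (Submodule.subset_span ⟨0, rfl⟩), hy _ (Submodule.subset_span ⟨1, rfl⟩)⟩
    · rintro ⟨h1, h2⟩ x hx
      induction hx using Submodule.span_induction with
      | mem x hx =>
        obtain ⟨i, rfl⟩ := hx
        fin_cases i
        · exact h1
        · exact h2
      | zero => simp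
      | add a b _ _ ha hb => rw [inner_add_right, ha, hb, add_zero]
      | smul r a _ ha => rw [inner_smul_right, ha, mul_zero]
  have hF1 : ‖F u‖ = 1 := h.norm_fst.self_of_nhds
  have hη1 : ‖η u‖ = 1 := h.norm_snd.self_of_nhds
  have hηF : ⟪η u, F u⟫ = 0 := h.inner_snd_fst.self_of_nhds
  have hon : Orthonormal ℝ ![F u, η u] := by
    refine ⟨fun i => ?_, fun i j hij => ?_⟩
    · fin_cases i
      · exact hF1
      · exact hη1
    · fin_cases i <;> fin_cases j
      · exact absurd rfl hij
      · simpa [real_inner_comm] using hηF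
      · simpa using hηF
      · exact absurd rfl hij
  have hK : finrank ℝ K + 2 = finrank ℝ E := by
    have h1 := finrank_span_eq_card hon.linearIndependent
    have h2 := Submodule.finrank_add_finrank_orthogonal (Submodule.span ℝ (range ![F u, η u]))
    rw [h1, Fintype.card_fin] at h2
    change _ + finrank ℝ K = _ at h2
    omega
  have hle : LinearMap.range (fderiv ℝ F u : V →ₗ[ℝ] E) ≤ K := by
    rintro _ ⟨w, rfl⟩
    exact (hmemK _).2 ⟨h.inner_fderiv_fst_fst w, h.inner_fderiv_fst_snd w⟩
  have heq : LinearMap.range (fderiv ℝ F u : V →ₗ[ℝ] E) = K := by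
    refine Submodule.eq_of_le_of_finrank_eq hle ?_
    rw [LinearMap.finrank_range_of_inj hinj]
    omega
  have hz : z ∈ LinearMap.range (fderiv ℝ F u : V →ₗ[ℝ] E) := heq ▸ (hmemK z).2 ⟨hz₁, hz₂⟩
  exact hz

/-- The smallest principal curvature. -/
theorem exists_min_curvature [FiniteDimensional ℝ V] [Nontrivial V] [FiniteDimensional ℝ E]
    (h : IsNormalPair F η u) (hinj : Function.Injective (fderiv ℝ F u))
    (hdim : finrank ℝ E = finrank ℝ V + 2) :
    ∃ m : ℝ, ∃ v ≠ 0, -fderiv ℝ η u v = m • fderiv ℝ F u v ∧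
      ∀ w, m * ‖fderiv ℝ F u w‖ ^ 2 ≤ -⟪fderiv ℝ η u w, fderiv ℝ F u w⟫ := by
  obtain ⟨m, v, hv, hmv, hlow⟩ := exists_min_eigenvalue hinj h.inner_fderiv_symm
  refine ⟨m, v, hv, ?_, hlow⟩
  obtain ⟨z, hz⟩ : ∃ z, z = -fderiv ℝ η u v - m • fderiv ℝ F u v := ⟨_, rfl⟩
  obtain ⟨w, hw⟩ := h.exists_fderiv_eq hinj hdim (z := z)
    (by rw [hz, inner_sub_left, inner_neg_left, real_inner_smul_left, h.inner_fderiv_snd_fst,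
      h.inner_fderiv_fst_fst]; ring)
    (by rw [hz, inner_sub_left, inner_neg_left, real_inner_smul_left, h.inner_fderiv_snd_snd,
      h.inner_fderiv_fst_snd]; ring)
  have h0 : ⟪z, z⟫ = 0 := by
    nth_rewrite 2 [← hw]
    rw [hz, inner_sub_left, hmv, real_inner_smul_left]
    ring
  rw [inner_self_eq_zero, hz, sub_eq_zero] at h0
  exact h0

/-- At a maximum of the height in the direction of the unit vector `p`, the vector `p` is normal to
the hypersurface, and the second derivative test bounds the second fundamental form. -/
theorem of_isLocalMax [FiniteDimensional ℝ E] (h : IsNormalPair F η u)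
    (hinj : Function.Injective (fderiv ℝ F u)) (hdim : finrank ℝ E = finrank ℝ V + 2) {p : E}
    (hmax : IsLocalMax (fun v => ⟪F v, p⟫) u) :
    p = ⟪F u, p⟫ • F u + ⟪η u, p⟫ • η u ∧
      ∀ w, ⟪η u, p⟫ * -⟪fderiv ℝ η u w, fderiv ℝ F u w⟫ ≤
        ⟪F u, p⟫ * ‖fderiv ℝ F u w‖ ^ 2 := by
  have hcrit : ∀ w, ⟪fderiv ℝ F u w, p⟫ = 0 := by
    intro w
    have h1 := congrArg (fun L => L w) hmax.fderiv_eq_zero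
    rw [fderiv_inner_apply ℝ h.differentiableAt_fst (differentiableAt_const p)] at h1
    simpa using h1
  have hF1 : ‖F u‖ = 1 := h.norm_fst.self_of_nhds
  have hη1 : ‖η u‖ = 1 := h.norm_snd.self_of_nhds
  have hηF : ⟪η u, F u⟫ = 0 := h.inner_snd_fst.self_of_nhds
  have hFη : ⟪F u, η u⟫ = 0 := by rw [real_inner_comm, hηF]
  have hp : p = ⟪F u, p⟫ • F u + ⟪η u, p⟫ • η u := by
    obtain ⟨z, hz⟩ : ∃ z, z = p - ⟪F u, p⟫ • F u - ⟪η u, p⟫ • η u := ⟨_, rfl⟩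
    have hzF : ⟪z, F u⟫ = 0 := by
      rw [hz, inner_sub_left, inner_sub_left, real_inner_smul_left, real_inner_smul_left, hηF,
        real_inner_self_eq_norm_sq, hF1, real_inner_comm]
      ring
    have hzη : ⟪z, η u⟫ = 0 := by
      rw [hz, inner_sub_left, inner_sub_left, real_inner_smul_left, real_inner_smul_left, hFη,
        real_inner_self_eq_norm_sq, hη1, real_inner_comm]
      ring
    obtain ⟨w, hw⟩ := h.exists_fderiv_eq hinj hdim hzF hzη
    have hzp : ⟪z, p⟫ = 0 := by rw [← hw, hcrit]
    have h0 : ⟪z, z⟫ = 0 := by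
      nth_rewrite 2 [hz]
      rw [inner_sub_right, inner_sub_right, real_inner_smul_right, real_inner_smul_right, hzF, hzη,
        hzp]
      ring
    rw [inner_self_eq_zero, hz, sub_sub, sub_eq_zero] at h0
    exact h0
  refine ⟨hp, fun w => ?_⟩
  have hd : DifferentiableAt ℝ (fderiv ℝ F) u := h.contDiffAt_fderiv_fst.differentiableAt (by simp)
  -- the second derivative of the position vector has position component `-‖dF w‖²`
  have hFF : ⟪F u, fderiv ℝ (fderiv ℝ F) u w w⟫ = -‖fderiv ℝ F u w‖ ^ 2 := by
    have hev : ∀ᶠ v in 𝓝 u, ⟪F v, fderiv ℝ F v w⟫ = 0 := by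
      filter_upwards [h.norm_fst.eventually_nhds,
        (h.contDiffAt_fst.of_le (m := 1) (by simp)).eventually (by simp)] with v hv hcv
      have hdv : DifferentiableAt ℝ F v := hcv.differentiableAt (by simp)
      have h1 := inner_fderiv_add_eq_zero hdv hdv (k := 1)
        (hv.mono fun x hx => by rw [real_inner_self_eq_norm_sq, hx, one_pow]) w
      rw [real_inner_comm (F v) (fderiv ℝ F v w)] at h1
      linarith
    have h1 := inner_fderiv_add_eq_zero (b := fun z => fderiv ℝ F z w) h.differentiableAt_fst
      (hd.clm_apply (differentiableAt_const w)) hev w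
    have h2 : fderiv ℝ (fun z => fderiv ℝ F z w) u w = fderiv ℝ (fderiv ℝ F) u w w := by
      rw [fderiv_clm_apply hd (differentiableAt_const w)]
      simp
    rw [h2, real_inner_self_eq_norm_sq] at h1
    linarith
  have hline : ∀ t : ℝ, HasDerivAt (fun t : ℝ => u + t • w) w t := fun t => by
    simpa using ((hasDerivAt_id t).smul_const w).const_add u
  have hline0 : Tendsto (fun t : ℝ => u + t • w) (𝓝 0) (𝓝 u) := by
    have := (hline 0).continuousAt.tendsto
    simpa using this
  have hmax1 : IsLocalMax (fun t : ℝ => ⟪F (u + t • w), p⟫) 0 := by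
    have := hline0.eventually hmax
    simpa [IsLocalMax, IsMaxFilter] using this
  have hder : deriv (fun t : ℝ => ⟪F (u + t • w), p⟫) =ᶠ[𝓝 0]
      fun t => ⟪fderiv ℝ F (u + t • w) w, p⟫ := by
    filter_upwards [hline0.eventually
      ((h.contDiffAt_fst.of_le (m := 1) (by simp)).eventually (by simp))] with t ht
    have h1 : HasDerivAt (fun t : ℝ => F (u + t • w)) (fderiv ℝ F (u + t • w) w) t :=
      (ht.differentiableAt (by simp)).hasFDerivAt.comp_hasDerivAt t (hline t)
    have h2 := h1.inner ℝ (hasDerivAt_const t p)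
    simpa using h2.deriv
  have hder2 : deriv (deriv fun t : ℝ => ⟪F (u + t • w), p⟫) 0 =
      ⟪fderiv ℝ (fderiv ℝ F) u w w, p⟫ := by
    rw [hder.deriv_eq]
    have h0 : HasFDerivAt (fderiv ℝ F) (fderiv ℝ (fderiv ℝ F) u) (u + (0 : ℝ) • w) := by
      simpa using hd.hasFDerivAt
    have h1 : HasDerivAt (fun t : ℝ => fderiv ℝ F (u + t • w)) (fderiv ℝ (fderiv ℝ F) u w) 0 :=
      h0.comp_hasDerivAt 0 (hline 0)
    have h2 := (h1.clm_apply (hasDerivAt_const 0 w)).inner ℝ (hasDerivAt_const 0 p)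
    simpa using h2.deriv
  have hle : ⟪fderiv ℝ (fderiv ℝ F) u w w, p⟫ ≤ 0 := by
    by_contra! hgt
    rw [← hder2] at hgt
    have hcont : ContinuousAt (fun t : ℝ => ⟪F (u + t • w), p⟫) 0 := by
      have hFc : ContinuousAt F (u + (0 : ℝ) • w) := by
        simpa using h.differentiableAt_fst.continuousAt
      exact (ContinuousAt.comp (f := fun t : ℝ => u + t • w) hFc (hline 0).continuousAt).inner
        continuousAt_const
    have hmin := isLocalMin_of_deriv_deriv_pos hgt hmax1.deriv_eq_zero hcont
    have hconst : (fun t : ℝ => ⟪F (u + t • w), p⟫) =ᶠ[𝓝 0] fun _ => ⟪F (u + (0 : ℝ) • w), p⟫ := by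
      filter_upwards [hmin, hmax1] with t h1 h2
      exact le_antisymm h2 h1
    have : deriv (deriv fun t : ℝ => ⟪F (u + t • w), p⟫) 0 = 0 := by
      rw [hconst.deriv.deriv_eq]
      simp
    linarith
  have hexp : ⟪fderiv ℝ (fderiv ℝ F) u w w, p⟫ =
      -(⟪F u, p⟫ * ‖fderiv ℝ F u w‖ ^ 2) +
        ⟪η u, p⟫ * -⟪fderiv ℝ η u w, fderiv ℝ F u w⟫ := by
    nth_rewrite 1 [hp]
    rw [inner_add_right, real_inner_smul_right, real_inner_smul_right,
      real_inner_comm (F u) (fderiv ℝ (fderiv ℝ F) u w w), hFF,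
      real_inner_comm (η u) (fderiv ℝ (fderiv ℝ F) u w w), h.inner_fderiv_fderiv]
    ring
  linarith

end IsNormalPair

end NormalPair

/-! ### The generalised cross product -/

section CrossProduct

variable {N : ℕ}

/-- The cross product of `N` vectors of `ℝᴺ⁺¹`: its coordinates are the signed maximal minors. -/
noncomputable def crossVec (a : Fin N → Euc (N + 1)) : Euc (N + 1) :=
  WithLp.toLp 2 fun k =>
    (-1) ^ (k : ℕ) * Matrix.det (Matrix.of fun i j : Fin N => a i (k.succAbove j))

theorem inner_crossVec (a : Fin N → Euc (N + 1)) (w : Euc (N + 1)) :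
    ⟪crossVec a, w⟫ =
      Matrix.det (Matrix.of fun i j => (Fin.cons w a : Fin (N + 1) → Euc (N + 1)) i j) := by
  rw [Matrix.det_succ_row_zero, PiLp.inner_apply]
  refine Finset.sum_congr rfl fun k _ => ?_
  simp only [crossVec, Matrix.of_apply, Fin.cons_zero, RCLike.inner_apply, conj_trivial]
  have : (Matrix.of fun i j => (Fin.cons w a : Fin (N + 1) → Euc (N + 1)) i j).submatrix Fin.succ
      k.succAbove = Matrix.of fun i j : Fin N => a i (k.succAbove j) := by
    ext i j
    simp
  rw [this]
  ring

theorem inner_crossVec_self (a : Fin N → Euc (N + 1)) (i : Fin N) : ⟪crossVec a, a i⟫ = 0 := by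
  rw [inner_crossVec]
  refine Matrix.det_zero_of_row_eq (i := 0) (j := i.succ) (Fin.succ_ne_zero i).symm ?_
  ext j
  simp

theorem crossVec_ne_zero {a : Fin N → Euc (N + 1)} (ha : LinearIndependent ℝ a) :
    crossVec a ≠ 0 := by
  intro h0
  have hspan : Submodule.span ℝ (range a) ≠ ⊤ := by
    intro htop
    have h1 := finrank_span_eq_card ha
    rw [htop, finrank_top, finrank_euclideanSpace_fin, Fintype.card_fin] at h1
    omega
  obtain ⟨w, hw⟩ : ∃ w, w ∉ Submodule.span ℝ (range a) := by
    by_contra! hall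
    exact hspan (eq_top_iff.2 fun w _ => hall w)
  have hli : LinearIndependent ℝ (Fin.cons w a : Fin (N + 1) → Euc (N + 1)) :=
    linearIndependent_finCons.2 ⟨ha, hw⟩
  have hli' := hli.map' (WithLp.linearEquiv 2 ℝ (Fin (N + 1) → ℝ)).toLinearMap
    (LinearEquiv.ker _)
  have hunit := Matrix.linearIndependent_rows_iff_isUnit
    (A := Matrix.of fun i j => (Fin.cons w a : Fin (N + 1) → Euc (N + 1)) i j) |>.1 hli'
  rw [Matrix.isUnit_iff_isUnit_det, ← inner_crossVec, h0, inner_zero_left] at hunit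
  exact not_isUnit_zero hunit

theorem ContDiffOn.crossVec {V : Type*} [NormedAddCommGroup V] [NormedSpace ℝ V] {m : ℕ∞ω}
    {a : V → Fin N → Euc (N + 1)} {O : Set V} (ha : ∀ i, ContDiffOn ℝ m (fun v => a v i) O) :
    ContDiffOn ℝ m (fun v => crossVec (a v)) O := by
  rw [contDiffOn_euclidean]
  intro k
  simp only [_root_.crossVec, Matrix.det_apply, Matrix.of_apply]
  refine contDiffOn_const.mul (ContDiffOn.sum fun σ _ => ContDiffOn.const_smul _ ?_)
  refine contDiffOn_prod fun i _ => ?_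
  exact contDiffOn_euclidean.1 (ha (σ i)) _

end CrossProduct

/-! ### Lifts and normals in charts -/

section Charts

variable {n : ℕ} {M : Type*} [TopologicalSpace M] [ChartedSpace (Euc n) M]
  {E : Type*} [NormedAddCommGroup E]

section
variable [NormedSpace ℝ E]

/-- In the chart around `x`, the derivatives at `y` of all maps to `E` are obtained from the
intrinsic ones by one and the same identification of the tangent space. -/
theorem exists_fderiv_chart_eq [IsManifold (𝓡 n) ∞ M] (E : Type*) [NormedAddCommGroup E]
    [NormedSpace ℝ E] {x y : M}
    (hy : y ∈ (chartAt (Euc n) x).source) :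
    ∃ T : Euc n ≃L[ℝ] TangentSpace (𝓡 n) y, ∀ F : M → E,
      MDifferentiableAt (𝓡 n) 𝓘(ℝ, E) F y → ∀ w,
        fderiv ℝ (F ∘ (chartAt (Euc n) x).symm) (chartAt (Euc n) x y) w =
          (mfderiv (𝓡 n) 𝓘(ℝ, E) F y (T w) : E) := by
  let φ := chartAt (Euc n) x
  have hφ : φ.MDifferentiable (𝓡 n) (𝓡 n) :=
    mdifferentiable_of_mem_atlas (chart_mem_atlas (Euc n) x)
  refine ⟨(hφ.mfderiv hy).symm, fun F hF w => ?_⟩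
  have h1 : MDifferentiableAt (𝓡 n) (𝓡 n) φ.symm (φ y) :=
    hφ.symm.mdifferentiableAt (φ.map_source hy)
  have h2 : MDifferentiableAt (𝓡 n) 𝓘(ℝ, E) F (φ.symm (φ y)) := by rwa [φ.left_inv hy]
  have h3 : MDifferentiableAt (𝓡 n) 𝓘(ℝ, E) (F ∘ φ.symm) (φ y) := h2.comp (φ y) h1
  have h4 : (F ∘ φ.symm) ∘ φ =ᶠ[𝓝 y] F := by
    filter_upwards [φ.open_source.mem_nhds hy] with z hz
    simp [φ.left_inv hz]
  have h5 := mfderiv_comp y h3 (hφ.mdifferentiableAt hy)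
  rw [h4.mfderiv_eq] at h5
  rw [h5, ← mfderiv_eq_fderiv]
  exact congrArg (mfderiv (𝓡 n) 𝓘(ℝ, E) (F ∘ φ.symm) (φ y))
    ((hφ.mfderiv hy).apply_symm_apply w).symm

theorem contDiffAt_comp_chart_symm [IsManifold (𝓡 n) ∞ M] {m : ℕ∞ω} (hm : m ≤ ∞) {F : M → E}
    {x y : M}
    (hy : y ∈ (chartAt (Euc n) x).source) (hF : ContMDiffAt (𝓡 n) 𝓘(ℝ, E) m F y) :
    ContDiffAt ℝ m (F ∘ (chartAt (Euc n) x).symm) (chartAt (Euc n) x y) := by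
  have h1 : ContMDiffAt (𝓡 n) (𝓡 n) m (chartAt (Euc n) x).symm (chartAt (Euc n) x y) :=
    (contMDiffOn_chart_symm.contMDiffAt ((chartAt (Euc n) x).open_target.mem_nhds
      ((chartAt (Euc n) x).map_source hy))).of_le hm
  rw [← contMDiffAt_iff_contDiffAt]
  refine ContMDiffAt.comp _ ?_ h1
  rwa [(chartAt (Euc n) x).left_inv hy]

theorem tendsto_chart_symm {x y : M} (hy : y ∈ (chartAt (Euc n) x).source) :
    Tendsto (chartAt (Euc n) x).symm (𝓝 (chartAt (Euc n) x y)) (𝓝 y) := by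
  have h := (chartAt (Euc n) x).continuousAt_symm ((chartAt (Euc n) x).map_source hy)
  rwa [ContinuousAt, (chartAt (Euc n) x).left_inv hy] at h

end

variable {f : M → RP (n + 1)} {F η : M → Euc (n + 2)} {x y : M}

namespace IsLocalUnitNormal

theorem mdifferentiableAt_lift (h : IsLocalUnitNormal f y F η) :
    MDifferentiableAt (𝓡 n) 𝓘(ℝ, Euc (n + 2)) F y :=
  h.contMDiffAt_lift.mdifferentiableAt (by simp)

theorem mdifferentiableAt_normal (h : IsLocalUnitNormal f y F η) :
    MDifferentiableAt (𝓡 n) 𝓘(ℝ, Euc (n + 2)) η y :=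
  h.contMDiffAt_normal.mdifferentiableAt (by simp)

theorem isNormalPair [IsManifold (𝓡 n) ∞ M] (h : IsLocalUnitNormal f y F η)
    (hy : y ∈ (chartAt (Euc n) x).source) :
    IsNormalPair (F ∘ (chartAt (Euc n) x).symm) (η ∘ (chartAt (Euc n) x).symm)
      (chartAt (Euc n) x y) where
  contDiffAt_fst := contDiffAt_comp_chart_symm le_rfl hy h.contMDiffAt_lift
  contDiffAt_snd := contDiffAt_comp_chart_symm le_rfl hy h.contMDiffAt_normal
  norm_fst := (tendsto_chart_symm hy).eventually h.norm_lift
  norm_snd := (tendsto_chart_symm hy).eventually h.norm_normal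
  inner_snd_fst := (tendsto_chart_symm hy).eventually h.inner_lift
  inner_fderiv := by
    have : IsManifold (𝓡 n) 1 M := IsManifold.of_le (n := ∞) (by simp)
    have hsm : ∀ᶠ z in 𝓝 y, ContMDiffAt (𝓡 n) 𝓘(ℝ, Euc (n + 2)) 1 F z :=
      (contMDiffAt_iff_contMDiffAt_nhds (by simp)).1 (h.contMDiffAt_lift.of_le (by simp))
    filter_upwards [(tendsto_chart_symm hy).eventually h.inner_tangent,
      (tendsto_chart_symm hy).eventually hsm,
      (chartAt (Euc n) x).open_target.mem_nhds ((chartAt (Euc n) x).map_source hy)]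
      with v hv hFv hvt w
    obtain ⟨T, hT⟩ := exists_fderiv_chart_eq (Euc (n + 2)) ((chartAt (Euc n) x).map_target hvt)
    have h1 := hT F (hFv.mdifferentiableAt (by simp)) w
    rw [(chartAt (Euc n) x).right_inv hvt] at h1
    rw [h1]
    exact hv (T w)

theorem congr {F' η' : M → Euc (n + 2)} (h : IsLocalUnitNormal f y F η) (hF : F' =ᶠ[𝓝 y] F)
    (hη : η' =ᶠ[𝓝 y] η) : IsLocalUnitNormal f y F' η' where
  contMDiffAt_lift := h.contMDiffAt_lift.congr_of_eventuallyEq hF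
  contMDiffAt_normal := h.contMDiffAt_normal.congr_of_eventuallyEq hη
  norm_lift := by filter_upwards [h.norm_lift, hF] with z h1 h2; rwa [h2]
  mk_lift := by filter_upwards [h.mk_lift, hF] with z h1 h2; simpa only [h2] using h1
  norm_normal := by filter_upwards [h.norm_normal, hη] with z h1 h2; rwa [h2]
  inner_lift := by filter_upwards [h.inner_lift, hF, hη] with z h1 h2 h3; rwa [h2, h3]
  inner_tangent := by
    filter_upwards [h.inner_tangent, hF.eventuallyEq_nhds, hη] with z h1 h2 h3 w
    rw [h3, h2.mfderiv_eq]
    exact h1 w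

theorem neg_normal (h : IsLocalUnitNormal f y F η) :
    IsLocalUnitNormal f y F (fun z => -η z) where
  contMDiffAt_lift := h.contMDiffAt_lift
  contMDiffAt_normal := h.contMDiffAt_normal.neg
  norm_lift := h.norm_lift
  mk_lift := h.mk_lift
  norm_normal := by simpa using h.norm_normal
  inner_lift := by simpa using h.inner_lift
  inner_tangent := by
    filter_upwards [h.inner_tangent] with z hz w
    exact (inner_neg_left _ _).trans (neg_eq_zero.2 (hz w))

theorem neg_lift (h : IsLocalUnitNormal f y F η) :
    IsLocalUnitNormal f y (fun z => -F z) η where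
  contMDiffAt_lift := h.contMDiffAt_lift.neg
  contMDiffAt_normal := h.contMDiffAt_normal
  norm_lift := by simpa using h.norm_lift
  mk_lift := by
    filter_upwards [h.mk_lift] with z hz
    obtain ⟨h0, hz⟩ := hz
    refine ⟨neg_ne_zero.2 h0, ?_⟩
    rw [← hz, Projectivization.mk_eq_mk_iff']
    exact ⟨-1, by simp⟩
  norm_normal := h.norm_normal
  inner_lift := by simpa using h.inner_lift
  inner_tangent := by
    filter_upwards [h.inner_tangent] with z hz w
    have h1 : mfderiv (𝓡 n) 𝓘(ℝ, Euc (n + 2)) (fun z => -F z) z =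
        -mfderiv (𝓡 n) 𝓘(ℝ, Euc (n + 2)) F z := mfderiv_neg
    rw [h1]
    exact (inner_neg_right _ _).trans (neg_eq_zero.2 (hz w))

end IsLocalUnitNormal

/-- A lift of an immersion is an immersion. -/
theorem IsSmoothImmersion.injective_mfderiv_lift (hf : IsSmoothImmersion f)
    (hF : MDifferentiableAt (𝓡 n) 𝓘(ℝ, Euc (n + 2)) F x)
    (hmk : ∀ᶠ y in 𝓝 x, ∃ h : F y ≠ 0, Projectivization.mk ℝ (F y) h = f y) :
    Function.Injective (mfderiv (𝓡 n) 𝓘(ℝ, Euc (n + 2)) F x) := by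
  obtain ⟨i, hi⟩ := RP.exists_mem_affineDomain (f x)
  obtain ⟨h0, hx⟩ := hmk.self_of_nhds
  have hFi : F x i ≠ 0 := by
    rw [← hx] at hi
    exact (RP.mk_mem_affineDomain i _ h0).1 hi
  let e : OpenPartialHomeomorph (RP (n + 1)) (Euc (n + 1)) := RP.affineChart i
  have he : e.MDifferentiable (𝓡 (n + 1)) (𝓡 (n + 1)) :=
    mdifferentiable_of_mem_atlas (mem_range_self i)
  let r : Euc (n + 2) → Euc (n + 1) := fun v => WithLp.toLp 2 fun j => v (i.succAbove j) / v i
  have hr : DifferentiableAt ℝ r (F x) := by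
    rw [differentiableAt_euclidean]
    intro j
    have hproj : ∀ k, DifferentiableAt ℝ (fun v : Euc (n + 2) => v k) (F x) := fun k => by fun_prop
    have hdiv : DifferentiableAt ℝ (fun v : Euc (n + 2) => v (i.succAbove j) * (v i)⁻¹) (F x) :=
      (hproj (i.succAbove j)).mul ((hproj i).inv hFi)
    simpa only [r, div_eq_mul_inv] using hdiv
  have heq : e ∘ f =ᶠ[𝓝 x] r ∘ F := by
    filter_upwards [hmk] with y hy
    obtain ⟨hy0, hy⟩ := hy
    change RP.affineCoord i (f y) = _
    rw [← hy, RP.affineCoord_mk]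
    rfl
  have hfx : MDifferentiableAt (𝓡 n) (𝓡 (n + 1)) f x := (hf.1 x).mdifferentiableAt (by simp)
  have h1 := mfderiv_comp x (he.mdifferentiableAt hi) hfx
  have h2 := mfderiv_comp x (I' := 𝓘(ℝ, Euc (n + 2))) hr.mdifferentiableAt hF
  rw [heq.mfderiv_eq, h2] at h1
  intro v w hvw
  refine hf.2 x (he.mfderiv_injective hi ?_)
  have h3 := congrArg (fun L => L v) h1
  have h4 := congrArg (fun L => L w) h1
  refine h3.symm.trans (Eq.trans ?_ h4)
  exact congrArg (mfderiv 𝓘(ℝ, Euc (n + 2)) (𝓡 (n + 1)) r (F x)) hvw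

/-- A smooth map to projective space lifts locally to the sphere. -/
theorem exists_local_lift (hf : ContMDiff (𝓡 n) (𝓡 (n + 1)) ∞ f) (x : M) :
    ∃ U, IsOpen U ∧ x ∈ U ∧ ∃ F : M → Euc (n + 2), ContMDiffOn (𝓡 n) 𝓘(ℝ, Euc (n + 2)) ∞ F U ∧
      ∀ y ∈ U, ‖F y‖ = 1 ∧ ∃ h : F y ≠ 0, Projectivization.mk ℝ (F y) h = f y := by
  obtain ⟨i, hi⟩ := RP.exists_mem_affineDomain (f x)
  let e : OpenPartialHomeomorph (RP (n + 1)) (Euc (n + 1)) := RP.affineChart i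
  have he : ContMDiffOn (𝓡 (n + 1)) (𝓡 (n + 1)) ∞ e e.source :=
    contMDiffOn_of_mem_maximalAtlas (IsManifold.subset_maximalAtlas (mem_range_self i))
  let s : Euc (n + 1) → Euc (n + 2) := fun u => ‖RP.affineVec i u‖⁻¹ • RP.affineVec i u
  have hvec : ContDiff ℝ ∞ (RP.affineVec i : Euc (n + 1) → Euc (n + 2)) :=
    contDiff_euclidean.2 fun k => RP.contDiff_affineVec_apply i k
  have hs : ContDiff ℝ ∞ s :=
    ((hvec.norm ℝ (RP.affineVec_ne_zero i)).inv fun u =>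
      norm_ne_zero_iff.2 (RP.affineVec_ne_zero i u)).smul hvec
  refine ⟨f ⁻¹' e.source, e.open_source.preimage hf.continuous, hi, s ∘ e ∘ f, ?_, fun y hy => ?_⟩
  · exact hs.contMDiff.comp_contMDiffOn (he.comp hf.contMDiffOn fun y hy => hy)
  · have h0 := RP.affineVec_ne_zero i (e (f y))
    have hn : ‖RP.affineVec i (e (f y))‖ ≠ 0 := norm_ne_zero_iff.2 h0
    have h1 : (s ∘ e ∘ f) y ≠ 0 := smul_ne_zero (inv_ne_zero hn) h0
    refine ⟨?_, h1, ?_⟩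
    · change ‖‖RP.affineVec i (e (f y))‖⁻¹ • RP.affineVec i (e (f y))‖ = 1
      rw [norm_smul, norm_inv, norm_norm, inv_mul_cancel₀ hn]
    · have h2 : Projectivization.mk ℝ _ h0 = f y := e.left_inv hy
      rw [← h2, Projectivization.mk_eq_mk_iff']
      exact ⟨‖RP.affineVec i (e (f y))‖⁻¹, rfl⟩

/-- An immersed hypersurface has local unit normals: the normalised cross product of the position
vector and the coordinate vector fields. -/
theorem IsSmoothImmersion.exists_isLocalUnitNormal [IsManifold (𝓡 n) ∞ M]
    (hf : IsSmoothImmersion f) (x : M) :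
    ∃ U, IsOpen U ∧ x ∈ U ∧ ∃ F η : M → Euc (n + 2), ∀ y ∈ U, IsLocalUnitNormal f y F η := by
  obtain ⟨U₀, hU₀, hxU₀, F, hF, hFU⟩ := exists_local_lift hf.1 x
  let φ := chartAt (Euc n) x
  let U : Set M := U₀ ∩ φ.source
  have hU : IsOpen U := hU₀.inter φ.open_source
  let O : Set (Euc n) := φ.target ∩ φ.symm ⁻¹' U₀
  have hO : IsOpen O := φ.isOpen_inter_preimage_symm hU₀
  let G : Euc n → Euc (n + 2) := F ∘ φ.symm
  have hG : ContDiffOn ℝ ∞ G O := by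
    rw [← contMDiffOn_iff_contDiffOn]
    exact hF.comp ((contMDiffOn_chart_symm (I := 𝓡 n) (n := ∞)).mono inter_subset_left)
      fun u hu => hu.2
  have hdG : ContDiffOn ℝ ∞ (fderiv ℝ G) O := hG.fderiv_of_isOpen hO (by simp)
  have hφU : ∀ y ∈ U, φ y ∈ O := fun y hy =>
    ⟨φ.map_source hy.2, by
      change φ.symm (φ y) ∈ U₀
      rw [φ.left_inv hy.2]
      exact hy.1⟩
  let a : Euc n → Fin (n + 1) → Euc (n + 2) := fun u =>
    Fin.cons (G u) fun i => fderiv ℝ G u (EuclideanSpace.basisFun (Fin n) ℝ i)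
  have ha : ∀ i, ContDiffOn ℝ ∞ (fun u => a u i) O := by
    intro i
    refine Fin.cases ?_ (fun j => ?_) i
    · simpa [a] using hG
    · simpa [a] using hdG.clm_apply contDiffOn_const
  have hFsm : ∀ y ∈ U, ContMDiffAt (𝓡 n) 𝓘(ℝ, Euc (n + 2)) ∞ F y := fun y hy =>
    hF.contMDiffAt (hU₀.mem_nhds hy.1)
  have hli : ∀ u ∈ O, LinearIndependent ℝ (a u) := by
    intro u hu
    let y := φ.symm u
    have hyφ : y ∈ φ.source := φ.map_target hu.1
    have hyu : φ y = u := φ.right_inv hu.1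
    have hyU : y ∈ U := ⟨hu.2, hyφ⟩
    obtain ⟨T, hT⟩ := exists_fderiv_chart_eq (Euc (n + 2)) hyφ
    have hmd : MDifferentiableAt (𝓡 n) 𝓘(ℝ, Euc (n + 2)) F y :=
      (hFsm y hyU).mdifferentiableAt (by simp)
    have hinj : Function.Injective (fderiv ℝ G u) := by
      intro v w hvw
      have h1 := hT F hmd v
      have h2 := hT F hmd w
      change fderiv ℝ G (φ y) v = _ at h1
      change fderiv ℝ G (φ y) w = _ at h2
      rw [hyu] at h1 h2
      refine T.injective (hf.injective_mfderiv_lift hmd ?_ (h1.symm.trans (hvw.trans h2)))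
      filter_upwards [hU₀.mem_nhds hyU.1] with z hz
      exact (hFU z hz).2
    have hGd : DifferentiableAt ℝ G u := (hG.contDiffAt (hO.mem_nhds hu)).differentiableAt (by simp)
    have hG1 : ∀ᶠ v in 𝓝 u, ⟪G v, G v⟫ = 1 := by
      filter_upwards [hO.mem_nhds hu] with v hv
      rw [real_inner_self_eq_norm_sq]
      change ‖F (φ.symm v)‖ ^ 2 = 1
      rw [(hFU _ hv.2).1, one_pow]
    have horth : ∀ w, ⟪G u, fderiv ℝ G u w⟫ = 0 := by
      intro w
      have h1 := inner_fderiv_add_eq_zero hGd hGd hG1 w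
      rw [real_inner_comm (G u) (fderiv ℝ G u w)] at h1
      linarith
    refine linearIndependent_finCons.2 ⟨?_, fun hmem => ?_⟩
    · have h1 := (EuclideanSpace.basisFun (Fin n) ℝ).toBasis.linearIndependent.map'
        (fderiv ℝ G u : Euc n →ₗ[ℝ] Euc (n + 2)) (LinearMap.ker_eq_bot.2 hinj)
      have h2 : (fderiv ℝ G u : Euc n →ₗ[ℝ] Euc (n + 2)) ∘
          (EuclideanSpace.basisFun (Fin n) ℝ).toBasis =
            fun i => fderiv ℝ G u (EuclideanSpace.basisFun (Fin n) ℝ i) := by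
        ext i
        simp
      rwa [h2] at h1
    · have h1 : ∀ z ∈ Submodule.span ℝ
          (range fun i => fderiv ℝ G u (EuclideanSpace.basisFun (Fin n) ℝ i)), ⟪G u, z⟫ = 0 := by
        intro z hz
        induction hz using Submodule.span_induction with
        | mem z hz =>
          obtain ⟨i, rfl⟩ := hz
          exact horth _
        | zero => simp
        | add b c _ _ hb hc => rw [inner_add_right, hb, hc, add_zero]
        | smul t b _ hb => rw [inner_smul_right, hb, mul_zero]
      have h2 := h1 _ hmem
      rw [hG1.self_of_nhds] at h2
      exact one_ne_zero h2
  let ν : Euc n → Euc (n + 2) := fun u => ‖crossVec (a u)‖⁻¹ • crossVec (a u)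
  have hc0 : ∀ u ∈ O, crossVec (a u) ≠ 0 := fun u hu => crossVec_ne_zero (hli u hu)
  have hν : ContDiffOn ℝ ∞ ν O :=
    (((ContDiffOn.crossVec ha).norm ℝ hc0).inv fun u hu => norm_ne_zero_iff.2 (hc0 u hu)).smul
      (ContDiffOn.crossVec ha)
  have hνF : ∀ u, ⟪ν u, G u⟫ = 0 := by
    intro u
    have := inner_crossVec_self (a u) 0
    rw [real_inner_smul_left]
    simp only [a, Fin.cons_zero] at this ⊢
    rw [this, mul_zero]
  have hνd : ∀ u w, ⟪ν u, fderiv ℝ G u w⟫ = 0 := by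
    intro u w
    have hw := (EuclideanSpace.basisFun (Fin n) ℝ).sum_repr w
    rw [← hw, map_sum, inner_sum]
    refine Finset.sum_eq_zero fun i _ => ?_
    have := inner_crossVec_self (a u) i.succ
    rw [map_smul, real_inner_smul_right, real_inner_smul_left]
    simp only [a, Fin.cons_succ] at this ⊢
    rw [this, mul_zero, mul_zero]
  refine ⟨U, hU, ⟨hxU₀, mem_chart_source _ x⟩, F, ν ∘ φ, fun y hy => ?_⟩
  have hUy : U ∈ 𝓝 y := hU.mem_nhds hy
  exact
    { contMDiffAt_lift := hFsm y hy
      contMDiffAt_normal := by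
        have h1 : ContMDiffOn (𝓡 n) (𝓡 n) ∞ φ φ.source := contMDiffOn_chart
        have h2 : ContMDiffOn (𝓡 n) 𝓘(ℝ, Euc (n + 2)) ∞ (ν ∘ φ) U :=
          (contMDiffOn_iff_contDiffOn.2 hν).comp (h1.mono inter_subset_right) hφU
        exact h2.contMDiffAt hUy
      norm_lift := by filter_upwards [hUy] with z hz using (hFU z hz.1).1
      mk_lift := by filter_upwards [hUy] with z hz using (hFU z hz.1).2
      norm_normal := by
        filter_upwards [hUy] with z hz
        change ‖‖crossVec (a (φ z))‖⁻¹ • crossVec (a (φ z))‖ = 1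
        rw [norm_smul, norm_inv, norm_norm,
          inv_mul_cancel₀ (norm_ne_zero_iff.2 (hc0 _ (hφU z hz)))]
      inner_lift := by
        filter_upwards [hUy] with z hz
        have h1 := hνF (φ z)
        change ⟪ν (φ z), F (φ.symm (φ z))⟫ = 0 at h1
        rwa [φ.left_inv hz.2] at h1
      inner_tangent := by
        filter_upwards [hUy] with z hz w
        obtain ⟨T, hT⟩ := exists_fderiv_chart_eq (Euc (n + 2)) hz.2
        have h1 := hT F ((hFsm z hz).mdifferentiableAt (by simp)) (T.symm w)
        rw [T.apply_symm_apply] at h1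
        rw [← h1]
        exact hνd (φ z) (T.symm w) }

end Charts

/-! ### Definiteness of the second fundamental form -/

section Curvature

variable {n : ℕ} {M : Type*} [TopologicalSpace M] [ChartedSpace (Euc n) M]

/-- All principal curvatures at `y` with respect to the unit normal `η` along `F` are at least `c`,
expressed through the first and the second fundamental form. -/
def CurvatureGE (c : ℝ) (F η : M → Euc (n + 2)) (y : M) : Prop :=
  ∀ v : TangentSpace (𝓡 n) y,
    c * norm (E := Euc (n + 2)) (mfderiv (𝓡 n) 𝓘(ℝ, Euc (n + 2)) F y v) ^ 2 ≤
      -inner (E := Euc (n + 2)) ℝ (mfderiv (𝓡 n) 𝓘(ℝ, Euc (n + 2)) η y v)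
        (mfderiv (𝓡 n) 𝓘(ℝ, Euc (n + 2)) F y v)

variable {f : M → RP (n + 1)} {F η : M → Euc (n + 2)} {x y : M} {c τ : ℝ}

namespace CurvatureGE

theorem congr {F' η' : M → Euc (n + 2)} (h : CurvatureGE c F η y) (hF : F' =ᶠ[𝓝 y] F)
    (hη : η' =ᶠ[𝓝 y] η) : CurvatureGE c F' η' y := by
  intro v
  rw [hF.mfderiv_eq, hη.mfderiv_eq]
  exact h v

theorem neg_neg (h : CurvatureGE c F η y) : CurvatureGE c (-F) (-η) y := by
  intro v
  rw [mfderiv_neg, mfderiv_neg]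
  have h1 := h v
  refine le_of_eq_of_le ?_ (h1.trans_eq ?_)
  · exact congrArg (fun t => c * t ^ 2) (norm_neg (E := Euc (n + 2)) _)
  · exact congrArg Neg.neg (inner_neg_neg (E := Euc (n + 2)) _ _).symm

end CurvatureGE

theorem tendsto_chart (x : M) :
    Tendsto (chartAt (Euc n) x) (𝓝 x) (𝓝 (chartAt (Euc n) x x)) :=
  (chartAt (Euc n) x).continuousAt (mem_chart_source (Euc n) x)

variable [IsManifold (𝓡 n) ∞ M]

theorem IsLocalUnitNormal.curvatureGE_iff (h : IsLocalUnitNormal f y F η)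
    (hy : y ∈ (chartAt (Euc n) x).source) :
    CurvatureGE c F η y ↔ ∀ w,
      c * ‖fderiv ℝ (F ∘ (chartAt (Euc n) x).symm) (chartAt (Euc n) x y) w‖ ^ 2 ≤
        -⟪fderiv ℝ (η ∘ (chartAt (Euc n) x).symm) (chartAt (Euc n) x y) w,
          fderiv ℝ (F ∘ (chartAt (Euc n) x).symm) (chartAt (Euc n) x y) w⟫ := by
  obtain ⟨T, hT⟩ := exists_fderiv_chart_eq (Euc (n + 2)) hy
  constructor
  · intro hc w
    rw [hT F h.mdifferentiableAt_lift w, hT η h.mdifferentiableAt_normal w]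
    exact hc (T w)
  · intro hc v
    have h1 := hc (T.symm v)
    rw [hT F h.mdifferentiableAt_lift, hT η h.mdifferentiableAt_normal, T.apply_symm_apply] at h1
    exact h1

theorem IsSmoothImmersion.injective_fderiv_chart (hf : IsSmoothImmersion f)
    (h : IsLocalUnitNormal f y F η) (hy : y ∈ (chartAt (Euc n) x).source) :
    Function.Injective
      (fderiv ℝ (F ∘ (chartAt (Euc n) x).symm) (chartAt (Euc n) x y)) := by
  obtain ⟨T, hT⟩ := exists_fderiv_chart_eq (Euc (n + 2)) hy
  intro v w hvw
  rw [hT F h.mdifferentiableAt_lift v, hT F h.mdifferentiableAt_lift w] at hvw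
  exact T.injective (hf.injective_mfderiv_lift h.mdifferentiableAt_lift h.mk_lift hvw)

theorem IsLocalUnitNormal.isPrincipalCurvature (h : IsLocalUnitNormal f y F η)
    (hy : y ∈ (chartAt (Euc n) x).source) {κ : ℝ} {w : Euc n} (hw : w ≠ 0)
    (hκ : -fderiv ℝ (η ∘ (chartAt (Euc n) x).symm) (chartAt (Euc n) x y) w =
      κ • fderiv ℝ (F ∘ (chartAt (Euc n) x).symm) (chartAt (Euc n) x y) w) :
    IsPrincipalCurvature f y κ := by
  obtain ⟨T, hT⟩ := exists_fderiv_chart_eq (Euc (n + 2)) hy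
  rw [hT F h.mdifferentiableAt_lift w, hT η h.mdifferentiableAt_normal w] at hκ
  exact ⟨F, η, h, T w, fun h0 => hw (T.injective (h0.trans (map_zero T).symm)), hκ⟩

/-- The gap in the spectrum of the shape operator: if no principal curvature lies in `(-c, c)`, then
the lower bound `-τ > -c` for the principal curvatures improves to `c`. -/
theorem IsLocalUnitNormal.curvatureGE_of_gap (hn : n ≠ 0) (hf : IsSmoothImmersion f)
    (hcurv : ∀ κ, IsPrincipalCurvature f y κ → c ≤ |κ|) (h : IsLocalUnitNormal f y F η)
    (hτ : τ < c) (hge : CurvatureGE (-τ) F η y) : CurvatureGE c F η y := by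
  have : NeZero n := ⟨hn⟩
  have hy := mem_chart_source (Euc n) y
  have hinj := hf.injective_fderiv_chart h hy
  obtain ⟨m, v, hv, hmv, hlow⟩ := (h.isNormalPair hy).exists_min_curvature hinj (by simp)
  rw [h.curvatureGE_iff hy] at hge ⊢
  have hpos : 0 < ‖fderiv ℝ (F ∘ (chartAt (Euc n) y).symm) (chartAt (Euc n) y y) v‖ ^ 2 := by
    have : 0 < ‖fderiv ℝ (F ∘ (chartAt (Euc n) y).symm) (chartAt (Euc n) y y) v‖ :=
      norm_pos_iff.2 fun h0 => hv (hinj (h0.trans (map_zero _).symm))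
    positivity
  have h1 := hge v
  rw [← inner_neg_left, hmv, real_inner_smul_left, real_inner_self_eq_norm_sq] at h1
  have h2 : -τ ≤ m := le_of_mul_le_mul_right h1 hpos
  have h3 : c ≤ |m| := hcurv m (h.isPrincipalCurvature hy hv hmv)
  have h4 : c ≤ m := by
    rcases le_abs.1 h3 with h5 | h5
    · exact h5
    · linarith
  intro w
  exact (mul_le_mul_of_nonneg_right h4 (sq_nonneg _)).trans (hlow w)

theorem eventually_eq_or_eq_neg {T E : Type*} [TopologicalSpace T] [NormedAddCommGroup E]
    [InnerProductSpace ℝ E] {a b : T → E} {t : T} (ha : ContinuousAt a t) (hb : ContinuousAt b t)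
    (hb0 : b t ≠ 0) (h : ∀ᶠ s in 𝓝 t, a s = b s ∨ a s = -b s) :
    a =ᶠ[𝓝 t] b ∨ a =ᶠ[𝓝 t] -b := by
  have hcont : ContinuousAt (fun s => ⟪a s, b s⟫) t := ha.inner hb
  have hpos : 0 < ‖b t‖ ^ 2 := by
    have := norm_pos_iff.2 hb0
    positivity
  rcases h.self_of_nhds with h0 | h0
  · left
    have h1 : 0 < ⟪a t, b t⟫ := by rwa [h0, real_inner_self_eq_norm_sq]
    filter_upwards [h, hcont.eventually (lt_mem_nhds h1)] with s hs hs1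
    refine hs.resolve_right fun hs2 => ?_
    rw [hs2, inner_neg_left, real_inner_self_eq_norm_sq] at hs1
    nlinarith [sq_nonneg ‖b s‖]
  · right
    have h1 : ⟪a t, b t⟫ < 0 := by rw [h0, inner_neg_left, real_inner_self_eq_norm_sq]; linarith
    filter_upwards [h, hcont.eventually (gt_mem_nhds h1)] with s hs hs1
    refine hs.resolve_left fun hs2 => ?_
    rw [hs2, real_inner_self_eq_norm_sq] at hs1
    nlinarith [sq_nonneg ‖b s‖]

/-- Local lifts and local unit normals are unique up to sign. -/
theorem IsLocalUnitNormal.eventually_eq_or_neg (hf : IsSmoothImmersion f) {U : Set M}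
    (hU : IsOpen U) (hUF : ∀ z ∈ U, IsLocalUnitNormal f z F η) (hy : y ∈ U)
    {F' η' : M → Euc (n + 2)} (h' : IsLocalUnitNormal f y F' η') :
    (F' =ᶠ[𝓝 y] F ∨ F' =ᶠ[𝓝 y] -F) ∧ (η' =ᶠ[𝓝 y] η ∨ η' =ᶠ[𝓝 y] -η) := by
  have h := hUF y hy
  have hF : F' =ᶠ[𝓝 y] F ∨ F' =ᶠ[𝓝 y] -F := by
    refine eventually_eq_or_eq_neg h'.contMDiffAt_lift.continuousAt
      h.contMDiffAt_lift.continuousAt h.mk_lift.self_of_nhds.1 ?_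
    filter_upwards [h.mk_lift, h'.mk_lift, h.norm_lift, h'.norm_lift] with z h1 h2 h3 h4
    obtain ⟨h10, h1⟩ := h1
    obtain ⟨h20, h2⟩ := h2
    obtain ⟨t, ht⟩ := (Projectivization.mk_eq_mk_iff' ℝ _ _ h20 h10).1 (h2.trans h1.symm)
    have h5 : |t| = 1 := by
      have := congrArg norm ht
      rwa [norm_smul, h3, h4, mul_one, Real.norm_eq_abs] at this
    rcases (abs_eq zero_le_one).1 h5 with rfl | rfl
    · left; rw [← ht, one_smul]
    · right; rw [← ht, neg_one_smul]
  refine ⟨hF, ?_⟩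
  have hη0 : η y ≠ 0 := by
    intro h0
    have := h.norm_normal.self_of_nhds
    rw [h0, norm_zero] at this
    exact zero_ne_one this
  refine eventually_eq_or_eq_neg h'.contMDiffAt_normal.continuousAt
    h.contMDiffAt_normal.continuousAt hη0 ?_
  -- `η'` is orthogonal to `F` and to the image of its derivative
  have horth : ∀ᶠ z in 𝓝 y, ⟪η' z, F z⟫ = 0 ∧ ∀ w : TangentSpace (𝓡 n) z,
      ⟪η' z, (mfderiv (𝓡 n) 𝓘(ℝ, Euc (n + 2)) F z w : Euc (n + 2))⟫ = 0 := by
    rcases hF with hF | hF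
    · filter_upwards [h'.inner_lift, h'.inner_tangent, hF.eventuallyEq_nhds] with z h1 h2 h3
      rw [h3.self_of_nhds] at h1
      rw [h3.mfderiv_eq] at h2
      exact ⟨h1, h2⟩
    · filter_upwards [h'.inner_lift, h'.inner_tangent, hF.eventuallyEq_nhds] with z h1 h2 h3
      rw [h3.self_of_nhds, Pi.neg_apply, inner_neg_right, neg_eq_zero] at h1
      refine ⟨h1, fun w => ?_⟩
      have h4 := h2 w
      rw [h3.mfderiv_eq, mfderiv_neg] at h4
      exact neg_eq_zero.1 ((inner_neg_right (E := Euc (n + 2)) _ _).symm.trans h4)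
  filter_upwards [hU.mem_nhds hy, horth, h'.norm_normal] with z hz h1 h2
  have hzs := mem_chart_source (Euc n) z
  have hp := (hUF z hz).isNormalPair hzs
  have hF1 : ‖η z‖ = 1 := (hUF z hz).norm_normal.self_of_nhds
  have hηF : ⟪η z, F z⟫ = 0 := (hUF z hz).inner_lift.self_of_nhds
  obtain ⟨d, hd⟩ : ∃ d, d = η' z - ⟪η' z, η z⟫ • η z := ⟨_, rfl⟩
  have hd1 : ⟪d, F z⟫ = 0 := by
    rw [hd, inner_sub_left, real_inner_smul_left, h1.1, hηF]
    ring
  have hd2 : ⟪d, η z⟫ = 0 := by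
    rw [hd, inner_sub_left, real_inner_smul_left, real_inner_self_eq_norm_sq, hF1]
    ring
  obtain ⟨w, hw⟩ := hp.exists_fderiv_eq (hf.injective_fderiv_chart (hUF z hz) hzs) (by simp)
    (z := d) (by simpa [(chartAt (Euc n) z).left_inv hzs] using hd1)
    (by simpa [(chartAt (Euc n) z).left_inv hzs] using hd2)
  obtain ⟨T, hT⟩ := exists_fderiv_chart_eq (Euc (n + 2)) hzs
  have hdη : ⟪η' z, d⟫ = 0 := by
    rw [← hw, hT F (hUF z hz).mdifferentiableAt_lift]
    exact h1.2 (T w)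
  have hd0 : d = 0 := by
    have h3 : ⟪d, d⟫ = 0 := by
      nth_rewrite 1 [hd]
      rw [inner_sub_left, real_inner_smul_left, hdη, real_inner_comm d (η z), hd2]
      ring
    exact inner_self_eq_zero.1 h3
  rw [hd, sub_eq_zero] at hd0
  have ht : |⟪η' z, η z⟫| = 1 := by
    have := congrArg norm hd0
    rwa [norm_smul, h2, hF1, mul_one, Real.norm_eq_abs, eq_comm] at this
  rcases (abs_eq zero_le_one).1 ht with h3 | h3
  · left; rw [hd0, h3, one_smul]
  · right; rw [hd0, h3, neg_one_smul]

theorem eventually_curvatureGE (hn : n ≠ 0) (hf : IsSmoothImmersion f) (hc : 0 < c)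
    (hcurv : ∀ z κ, IsPrincipalCurvature f z κ → c ≤ |κ|) {U : Set M} (hU : IsOpen U)
    (hUF : ∀ z ∈ U, IsLocalUnitNormal f z F η) (hx : x ∈ U) (hge : CurvatureGE c F η x) :
    ∀ᶠ z in 𝓝 x, CurvatureGE c F η z := by
  have hxs := mem_chart_source (Euc n) x
  have hp := (hUF x hx).isNormalPair hxs
  have h1 := eventually_nonneg_form hp.contDiffAt_fderiv_fst.continuousAt
    hp.contDiffAt_fderiv_snd.continuousAt (hf.injective_fderiv_chart (hUF x hx) hxs) hc
    (((hUF x hx).curvatureGE_iff hxs).1 hge)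
  filter_upwards [(tendsto_chart x).eventually h1, hU.mem_nhds hx,
    (chartAt (Euc n) x).open_source.mem_nhds hxs] with z hz hzU hzs
  refine (hUF z hzU).curvatureGE_of_gap hn hf (hcurv z) hc
    (((hUF z hzU).curvatureGE_iff hzs).2 fun w => ?_)
  rw [neg_zero, zero_mul]
  exact hz w

theorem eventually_not_curvatureGE {U : Set M} (hU : IsOpen U)
    (hUF : ∀ z ∈ U, IsLocalUnitNormal f z F η) (hx : x ∈ U) (hge : ¬CurvatureGE c F η x) :
    ∀ᶠ z in 𝓝 x, ¬CurvatureGE c F η z := by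
  have hxs := mem_chart_source (Euc n) x
  have hp := (hUF x hx).isNormalPair hxs
  rw [(hUF x hx).curvatureGE_iff hxs] at hge
  push Not at hge
  obtain ⟨w, hw⟩ := hge
  have hA := hp.contDiffAt_fderiv_fst.continuousAt.clm_apply (continuousAt_const (y := w))
  have hB := hp.contDiffAt_fderiv_snd.continuousAt.clm_apply (continuousAt_const (y := w))
  have h1 := (hB.inner hA).neg.eventually_lt ((hA.norm.pow 2).const_mul c) hw
  filter_upwards [(tendsto_chart x).eventually h1, hU.mem_nhds hx,
    (chartAt (Euc n) x).open_source.mem_nhds hxs] with z hz hzU hzs hzc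
  exact absurd (((hUF z hzU).curvatureGE_iff hzs).1 hzc w) (not_le.2 hz)

/-- If no principal curvature lies in `(-c, c)` and the second fundamental form is definite at one
point of a connected hypersurface, then it is definite everywhere, and locally the unit normal can
be chosen so that all principal curvatures are at least `c`. -/
theorem exists_curvatureGE [PreconnectedSpace M] (hn : n ≠ 0) (hf : IsSmoothImmersion f)
    (hc : 0 < c) (hcurv : ∀ z κ, IsPrincipalCurvature f z κ → c ≤ |κ|) {x₀ : M}
    (hx₀ : ∃ F η, IsLocalUnitNormal f x₀ F η ∧ CurvatureGE c F η x₀) (x : M) :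
    ∃ U, IsOpen U ∧ x ∈ U ∧ ∃ F η : M → Euc (n + 2),
      ∀ y ∈ U, IsLocalUnitNormal f y F η ∧ CurvatureGE c F η y := by
  let D : Set M := {y | ∃ F η, IsLocalUnitNormal f y F η ∧ CurvatureGE c F η y}
  have hD : ∀ (U : Set M) (F η : M → Euc (n + 2)), IsOpen U →
      (∀ z ∈ U, IsLocalUnitNormal f z F η) → ∀ z ∈ U,
        (z ∈ D ↔ CurvatureGE c F η z ∨ CurvatureGE c F (-η) z) := by
    intro U F η hU hUF z hz
    constructor
    · rintro ⟨F', η', h', hge⟩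
      obtain ⟨h1 | h1, h2 | h2⟩ := IsLocalUnitNormal.eventually_eq_or_neg hf hU hUF hz h'
      · exact Or.inl (hge.congr h1.symm h2.symm)
      · exact Or.inr (hge.congr h1.symm h2.symm)
      · refine Or.inr ((CurvatureGE.neg_neg (hge.congr h1.symm h2.symm)).congr ?_ ?_)
        · rw [neg_neg]
        · rfl
      · refine Or.inl ((CurvatureGE.neg_neg (hge.congr h1.symm h2.symm)).congr ?_ ?_) <;>
          rw [neg_neg]
    · rintro (h | h)
      · exact ⟨F, η, hUF z hz, h⟩
      · exact ⟨F, -η, (hUF z hz).neg_normal, h⟩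
  have hclopen : IsClopen D := by
    constructor
    · rw [← isOpen_compl_iff, isOpen_iff_mem_nhds]
      intro y hy
      obtain ⟨U, hU, hyU, F, η, hUF⟩ := hf.exists_isLocalUnitNormal y
      rw [mem_compl_iff, hD U F η hU hUF y hyU, not_or] at hy
      filter_upwards [hU.mem_nhds hyU, eventually_not_curvatureGE hU hUF hyU hy.1,
        eventually_not_curvatureGE hU (fun z hz => (hUF z hz).neg_normal) hyU hy.2]
        with z hz h1 h2
      rw [mem_compl_iff, hD U F η hU hUF z hz, not_or]
      exact ⟨h1, h2⟩
    · rw [isOpen_iff_mem_nhds]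
      intro y hy
      obtain ⟨U, hU, hyU, F, η, hUF⟩ := hf.exists_isLocalUnitNormal y
      rcases (hD U F η hU hUF y hyU).1 hy with h | h
      · filter_upwards [hU.mem_nhds hyU, eventually_curvatureGE hn hf hc hcurv hU hUF hyU h]
          with z hz h1
        exact (hD U F η hU hUF z hz).2 (Or.inl h1)
      · filter_upwards [hU.mem_nhds hyU, eventually_curvatureGE hn hf hc hcurv hU
          (fun z hz => (hUF z hz).neg_normal) hyU h] with z hz h1
        exact (hD U F η hU hUF z hz).2 (Or.inr h1)
  have huniv : D = univ := hclopen.eq_univ ⟨x₀, hx₀⟩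
  have hloc : ∀ (U : Set M) (F η : M → Euc (n + 2)), IsOpen U → x ∈ U →
      (∀ z ∈ U, IsLocalUnitNormal f z F η) → CurvatureGE c F η x →
      ∃ U, IsOpen U ∧ x ∈ U ∧ ∃ F η : M → Euc (n + 2),
        ∀ y ∈ U, IsLocalUnitNormal f y F η ∧ CurvatureGE c F η y := by
    intro U F η hU hxU hUF h
    obtain ⟨V, hV, hVo, hxV⟩ :=
      eventually_nhds_iff.1 (eventually_curvatureGE hn hf hc hcurv hU hUF hxU h)
    exact ⟨U ∩ V, hU.inter hVo, ⟨hxU, hxV⟩, F, η, fun y hy => ⟨hUF y hy.1, hV y hy.2⟩⟩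
  obtain ⟨U, hU, hxU, F, η, hUF⟩ := hf.exists_isLocalUnitNormal x
  rcases (hD U F η hU hUF x hxU).1 (huniv ▸ mem_univ x) with h | h
  · exact hloc U F η hU hxU hUF h
  · exact hloc U F (-η) hU hxU (fun z hz => (hUF z hz).neg_normal) h

end Curvature

/-! ### The Gauss map -/

section GaussMap

variable {E : Type*} [NormedAddCommGroup E] [InnerProductSpace ℝ E]

/-- For a unit vector `z.2` tangent to the unit sphere at `z.1`, the vector of `p^⊥` obtained from
it by parallel transport to `p` along the shortest geodesic. -/
noncomputable def gaussVec (p : E) (z : E × E) : E :=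
  z.2 - (⟪z.2, p⟫ / (1 + ⟪z.1, p⟫)) • (z.1 + p)

variable {p v w : E}

theorem inner_gaussVec (hp : ‖p‖ = 1) (ha : 1 + ⟪v, p⟫ ≠ 0) : ⟪gaussVec p (v, w), p⟫ = 0 := by
  rw [gaussVec, inner_sub_left, real_inner_smul_left, inner_add_left, real_inner_self_eq_norm_sq,
    hp]
  field_simp
  ring

theorem norm_gaussVec (hp : ‖p‖ = 1) (hv : ‖v‖ = 1) (hw : ‖w‖ = 1) (hwv : ⟪w, v⟫ = 0)
    (ha : 1 + ⟪v, p⟫ ≠ 0) : ‖gaussVec p (v, w)‖ = 1 := by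
  have h1 : ‖gaussVec p (v, w)‖ ^ 2 = 1 := by
    rw [gaussVec, norm_sub_sq_real, real_inner_smul_right, inner_add_right, norm_smul, mul_pow,
      norm_add_sq_real, Real.norm_eq_abs, sq_abs, hp, hv, hw, hwv]
    field_simp
    ring
  nlinarith [norm_nonneg (gaussVec p (v, w))]

/-- The two lifts of a point of projective space at which `p` is normal to the hypersurface have the
same image under the Gauss map. -/
theorem gaussVec_neg (hp : p = ⟪v, p⟫ • v + ⟪w, p⟫ • w) (hab : ⟪v, p⟫ ^ 2 + ⟪w, p⟫ ^ 2 = 1)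
    (ha : 1 + ⟪v, p⟫ ≠ 0) (ha' : 1 - ⟪v, p⟫ ≠ 0) :
    gaussVec p (-(v, w)) = gaussVec p (v, w) := by
  obtain ⟨a, haa⟩ : ∃ a, ⟪v, p⟫ = a := ⟨_, rfl⟩
  obtain ⟨b, hbb⟩ : ∃ b, ⟪w, p⟫ = b := ⟨_, rfl⟩
  rw [haa] at ha ha'
  rw [haa, hbb] at hp hab
  have ha'' : 1 + -a ≠ 0 := by rwa [← sub_eq_add_neg]
  have h1 : gaussVec p (v, w) = a • w - b • v := by
    simp only [gaussVec, haa, hbb]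
    have h2 : w - (b / (1 + a)) • (v + p) = (1 - b ^ 2 / (1 + a)) • w - b • v := by
      rw [hp]
      match_scalars <;> field_simp
    rw [h2]
    congr 2
    field_simp
    linarith
  have h1' : gaussVec p (-(v, w)) = a • w - b • v := by
    simp only [gaussVec, Prod.neg_mk, inner_neg_left, haa, hbb]
    have h2 : -w - (-b / (1 + -a)) • (-v + p) = (b ^ 2 / (1 + -a) - 1) • w - b • v := by
      rw [hp]
      match_scalars <;> field_simp <;> ring
    rw [h2]
    congr 2
    field_simp
    linarith
  rw [h1, h1']

theorem contDiffAt_gaussVec {z : E × E} (ha : 1 + ⟪z.1, p⟫ ≠ 0) {m : ℕ∞ω} :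
    ContDiffAt ℝ m (gaussVec p) z := by
  have h1 : ContDiffAt ℝ m (fun z : E × E => ⟪z.1, p⟫) z := contDiffAt_fst.inner ℝ contDiffAt_const
  have h2 : ContDiffAt ℝ m (fun z : E × E => ⟪z.2, p⟫) z := contDiffAt_snd.inner ℝ contDiffAt_const
  exact contDiffAt_snd.sub
    ((h2.div (contDiffAt_const.add h1) ha).smul (contDiffAt_fst.add contDiffAt_const))

theorem sq_inner_add_sq_inner_le (hp : ‖p‖ = 1) (hv : ‖v‖ = 1) (hw : ‖w‖ = 1) (hwv : ⟪w, v⟫ = 0) :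
    ⟪v, p⟫ ^ 2 + ⟪w, p⟫ ^ 2 ≤ 1 := by
  have h1 : 0 ≤ ‖p - ⟪v, p⟫ • v - ⟪w, p⟫ • w‖ ^ 2 := sq_nonneg _
  rw [norm_sub_sq_real, norm_sub_sq_real, inner_sub_left, real_inner_smul_right,
    real_inner_smul_right, real_inner_smul_right, real_inner_smul_left, norm_smul, norm_smul,
    mul_pow, mul_pow, Real.norm_eq_abs, Real.norm_eq_abs, sq_abs, sq_abs, hp, hv, hw,
    real_inner_comm v p, real_inner_comm w p, real_inner_comm w v, hwv] at h1
  nlinarith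

/-- A vector in the kernel of the derivative of the Gauss map is a principal vector, and the
corresponding principal curvature is the logarithmic derivative of the conformal factor of the
stereographic projection in the normal direction. -/
theorem IsNormalPair.eq_of_fderiv_gaussVec_eq_zero {V : Type*} [NormedAddCommGroup V]
    [NormedSpace ℝ V] {F η : V → E} {u : V} (h : IsNormalPair F η u) (ha : 1 + ⟪F u, p⟫ ≠ 0)
    {x : V} (hx : fderiv ℝ (fun y => gaussVec p (F y, η y)) u x = 0) :
    -fderiv ℝ η u x = (-(⟪η u, p⟫ / (1 + ⟪F u, p⟫))) • fderiv ℝ F u x := by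
  let μ : V → ℝ := fun y => ⟪η y, p⟫ / (1 + ⟪F y, p⟫)
  have hF := h.differentiableAt_fst
  have hη := h.differentiableAt_snd
  have hμ : DifferentiableAt ℝ μ u := by
    have h1 : DifferentiableAt ℝ (fun y => ⟪F y, p⟫) u := hF.inner ℝ (differentiableAt_const p)
    have h2 : DifferentiableAt ℝ (fun y => ⟪η y, p⟫) u := hη.inner ℝ (differentiableAt_const p)
    have h3 : DifferentiableAt ℝ (fun y => ⟪η y, p⟫ * (1 + ⟪F y, p⟫)⁻¹) u :=
      h2.mul ((h1.const_add 1).inv ha)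
    simpa only [μ, div_eq_mul_inv] using h3
  have hder : HasFDerivAt (fun y => gaussVec p (F y, η y))
      (fderiv ℝ η u - (μ u • fderiv ℝ F u + (fderiv ℝ μ u).smulRight (F u + p))) u :=
    hη.hasFDerivAt.sub (hμ.hasFDerivAt.smul (hF.hasFDerivAt.add_const p))
  rw [hder.fderiv] at hx
  simp only [sub_apply, add_apply, smul_apply, ContinuousLinearMap.smulRight_apply] at hx
  -- the component along the position vector shows that `dμ x = 0`
  have h0 : fderiv ℝ μ u x = 0 := by
    have h1 := congrArg (fun y => ⟪y, F u⟫) hx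
    simp only [inner_sub_left, inner_add_left, real_inner_smul_left, h.inner_fderiv_snd_fst,
      h.inner_fderiv_fst_fst, inner_zero_left, real_inner_self_eq_norm_sq,
      h.norm_fst.self_of_nhds, real_inner_comm (F u) p] at h1
    have h2 : fderiv ℝ μ u x * (1 + ⟪F u, p⟫) = 0 := by linarith
    exact (mul_eq_zero.1 h2).resolve_right ha
  rw [h0, zero_smul, add_zero, sub_eq_zero] at hx
  rw [hx, neg_smul]

end GaussMap

section GaussSphere

variable {n : ℕ}

/-- Coordinates on `p^⊥`. -/
theorem exists_isometry_orthogonal {p : Euc (n + 2)} (hp : p ≠ 0) :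
    ∃ L : Euc (n + 2) →L[ℝ] Euc (n + 1), ∀ z, ⟪z, p⟫ = 0 → ‖L z‖ = ‖z‖ := by
  have : Fact (finrank ℝ (Euc (n + 2)) = (n + 1) + 1) := ⟨by simp⟩
  let b := OrthonormalBasis.fromOrthogonalSpanSingleton (𝕜 := ℝ) (n + 1) hp
  refine ⟨(b.repr.toContinuousLinearEquiv : _ →L[ℝ] Euc (n + 1)).comp
    (ℝ ∙ p)ᗮ.orthogonalProjectionOnto, fun z hz => ?_⟩
  have hz' : z ∈ (ℝ ∙ p)ᗮ := Submodule.mem_orthogonal_singleton_iff_inner_left.2 hz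
  have h1 : (ℝ ∙ p)ᗮ.orthogonalProjectionOnto z = ⟨z, hz'⟩ :=
    Submodule.orthogonalProjectionOnto_mem_subspace_eq_self (⟨z, hz'⟩ : (ℝ ∙ p)ᗮ)
  change ‖b.repr ((ℝ ∙ p)ᗮ.orthogonalProjectionOnto z)‖ = ‖z‖
  rw [h1, b.repr.norm_map]
  rfl

open Classical in
/-- The Gauss map with values in the sphere, in the coordinates `L` of `p^⊥`. It has an arbitrary
constant value where the vector `gaussVec p z` does not have norm one. -/
noncomputable def gaussSphere (p : Euc (n + 2)) (L : Euc (n + 2) →L[ℝ] Euc (n + 1))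
    (z : Euc (n + 2) × Euc (n + 2)) : Sph n :=
  if h : ‖L (gaussVec p z)‖ = 1 then ⟨L (gaussVec p z), by simpa using h⟩
  else ⟨EuclideanSpace.single 0 1, by simp⟩

variable {M : Type*} [TopologicalSpace M] [ChartedSpace (Euc n) M]
  {f : M → RP (n + 1)} {p : Euc (n + 2)} {s c : ℝ}

/-- The unit lifts of the points of `f` lie in the tube of radius `arcsin s` about the hyperplane
`p^⊥`, and the threshold `c` for the principal curvatures exceeds `√((1 + s) / (1 - s))`. -/
structure TubeBound (f : M → RP (n + 1)) (p : Euc (n + 2)) (s c : ℝ) : Prop where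
  norm_pole : ‖p‖ = 1
  nonneg : 0 ≤ s
  lt_one : s < 1
  abs_inner_le : ∀ x v, ‖v‖ = 1 → (∃ h : v ≠ 0, Projectivization.mk ℝ v h = f x) → |⟪v, p⟫| ≤ s
  pos : 0 < c
  lt_sq : 1 + s < c ^ 2 * (1 - s)
  le_abs : ∀ x κ, IsPrincipalCurvature f x κ → c ≤ |κ|

namespace TubeBound

variable {F η : M → Euc (n + 2)} {x : M} {L : Euc (n + 2) →L[ℝ] Euc (n + 1)}

theorem abs_inner_lift_le (hb : TubeBound f p s c) (h : IsLocalUnitNormal f x F η) :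
    |⟪F x, p⟫| ≤ s :=
  hb.abs_inner_le x (F x) h.norm_lift.self_of_nhds h.mk_lift.self_of_nhds

theorem one_add_pos (hb : TubeBound f p s c) (h : IsLocalUnitNormal f x F η) :
    0 < 1 + ⟪F x, p⟫ := by
  have := (abs_le.1 (hb.abs_inner_lift_le h)).1
  linarith [hb.lt_one]

theorem one_sub_pos (hb : TubeBound f p s c) (h : IsLocalUnitNormal f x F η) :
    0 < 1 - ⟪F x, p⟫ := by
  have := (abs_le.1 (hb.abs_inner_lift_le h)).2
  linarith [hb.lt_one]

theorem norm_gaussVec (hb : TubeBound f p s c) (h : IsLocalUnitNormal f x F η) :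
    ‖gaussVec p (F x, η x)‖ = 1 :=
  _root_.norm_gaussVec hb.norm_pole h.norm_lift.self_of_nhds h.norm_normal.self_of_nhds
    h.inner_lift.self_of_nhds (hb.one_add_pos h).ne'

theorem inner_gaussVec (hb : TubeBound f p s c) (h : IsLocalUnitNormal f x F η) :
    ⟪gaussVec p (F x, η x), p⟫ = 0 :=
  _root_.inner_gaussVec hb.norm_pole (hb.one_add_pos h).ne'

theorem coe_gaussSphere (hb : TubeBound f p s c) (hL : ∀ z, ⟪z, p⟫ = 0 → ‖L z‖ = ‖z‖)
    (h : IsLocalUnitNormal f x F η) :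
    (gaussSphere p L (F x, η x) : Euc (n + 1)) = L (gaussVec p (F x, η x)) := by
  have h1 : ‖L (gaussVec p (F x, η x))‖ = 1 := by
    rw [hL _ (hb.inner_gaussVec h), hb.norm_gaussVec h]
  rw [gaussSphere, dif_pos h1]

variable [IsManifold (𝓡 n) ∞ M]

/-- The Gauss map is a local diffeomorphism: a vector in the kernel of its derivative would be a
principal vector with a principal curvature of absolute value at most `√((1 + s) / (1 - s))`. -/
theorem isLocalDiffeomorphAt_gaussSphere (hb : TubeBound f p s c)
    (hL : ∀ z, ⟪z, p⟫ = 0 → ‖L z‖ = ‖z‖) {U : Set M} (hU : IsOpen U)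
    (hUF : ∀ z ∈ U, IsLocalUnitNormal f z F η) (hx : x ∈ U) :
    IsLocalDiffeomorphAt (𝓡 n) (𝓡 n) ∞ (fun z => gaussSphere p L (F z, η z)) x := by
  let g : M → Euc (n + 2) := fun z => gaussVec p (F z, η z)
  have hg : ContMDiffOn (𝓡 n) 𝓘(ℝ, Euc (n + 2)) ∞ g U := fun z hz =>
    ((contDiffAt_gaussVec (z := (F z, η z)) (hb.one_add_pos (hUF z hz)).ne').contMDiffAt.comp z
      ((hUF z hz).contMDiffAt_lift.prodMk_space
        (hUF z hz).contMDiffAt_normal)).contMDiffWithinAt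
  have hcoe : ∀ z ∈ U, (gaussSphere p L (F z, η z) : Euc (n + 1)) = L (g z) := fun z hz =>
    hb.coe_gaussSphere hL (hUF z hz)
  have : Fact (finrank ℝ (Euc (n + 1)) = n + 1) := ⟨by simp⟩
  have hsm : ContMDiffOn (𝓡 n) (𝓡 n) ∞ (fun z => gaussSphere p L (F z, η z)) U :=
    contMDiffOn_of_coe_sphere ((L.contDiff.contMDiff.comp_contMDiffOn hg).congr hcoe)
  refine isLocalDiffeomorphAt_of_injective_mfderiv hU hsm (fun z hz => ?_) hx
  rw [injective_iff_map_eq_zero]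
  intro v hv
  have hzs := mem_chart_source (Euc n) z
  have h := hUF z hz
  have hpair := h.isNormalPair hzs
  obtain ⟨T, hT⟩ := exists_fderiv_chart_eq (Euc (n + 2)) hzs
  have hgz : MDifferentiableAt (𝓡 n) 𝓘(ℝ, Euc (n + 2)) g z :=
    (hg.contMDiffAt (hU.mem_nhds hz)).mdifferentiableAt (by simp)
  have hLg : L (mfderiv (𝓡 n) 𝓘(ℝ, Euc (n + 2)) g z v) = 0 := by
    have hev : (fun y => (gaussSphere p L (F y, η y) : Euc (n + 1))) =ᶠ[𝓝 z] L ∘ g := by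
      filter_upwards [hU.mem_nhds hz] with y hy using hcoe y hy
    have h1 := mfderiv_comp z (I' := 𝓘(ℝ, Euc (n + 2))) (g := L)
      L.differentiableAt.mdifferentiableAt hgz
    have h2 := mfderiv_comp z (I' := 𝓡 n) (g := fun y : Sph n => (y : Euc (n + 1)))
      ((contMDiff_coe_sphere (m := ∞) _).mdifferentiableAt (by simp))
      ((hsm.contMDiffAt (hU.mem_nhds hz)).mdifferentiableAt (by simp))
    have h3 := hev.mfderiv_eq (I := 𝓡 n) (I' := 𝓘(ℝ, Euc (n + 1)))
    rw [h1, mfderiv_eq_fderiv, L.fderiv] at h3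
    have h4 := congrArg (fun A => A v) (h3.symm.trans h2)
    refine Eq.trans h4 ?_
    refine Eq.trans (congrArg (mfderiv (𝓡 n) 𝓘(ℝ, Euc (n + 1))
      (fun y : Sph n => (y : Euc (n + 1))) (gaussSphere p L (F z, η z))) hv) ?_
    exact map_zero _
  obtain ⟨G, hG⟩ : ∃ G, G = g ∘ (chartAt (Euc n) z).symm := ⟨_, rfl⟩
  obtain ⟨u, hu⟩ : ∃ u, u = chartAt (Euc n) z z := ⟨_, rfl⟩
  have hGv : fderiv ℝ G u (T.symm v) = mfderiv (𝓡 n) 𝓘(ℝ, Euc (n + 2)) g z v := by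
    rw [hG, hu, hT g hgz, T.apply_symm_apply]
  have hGd : DifferentiableAt ℝ G u := by
    rw [hG, hu]
    exact (contDiffAt_comp_chart_symm le_rfl hzs
      (hg.contMDiffAt (hU.mem_nhds hz))).differentiableAt (by simp)
  have horth : ⟪fderiv ℝ G u (T.symm v), p⟫ = 0 := by
    have hev : ∀ᶠ y in 𝓝 u, ⟪G y, p⟫ = 0 := by
      rw [hu]
      filter_upwards [(tendsto_chart_symm hzs).eventually (hU.mem_nhds hz)] with y hy
      rw [hG]
      exact hb.inner_gaussVec (hUF _ hy)
    have h1 := inner_fderiv_add_eq_zero hGd (differentiableAt_const p) hev (T.symm v)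
    simpa using h1
  have hG0 : fderiv ℝ G u (T.symm v) = 0 := by
    rw [← norm_eq_zero, ← hL _ horth, hGv, hLg, norm_zero]
  by_contra hv0
  have hw0 : T.symm v ≠ 0 := fun h0 => hv0 (T.symm.injective (h0.trans (map_zero _).symm))
  have hz0 : (chartAt (Euc n) z).symm (chartAt (Euc n) z z) = z :=
    (chartAt (Euc n) z).left_inv hzs
  have ha := hb.one_add_pos h
  have hprin := hpair.eq_of_fderiv_gaussVec_eq_zero (p := p) (x := T.symm v)
    (by simpa [hz0] using ha.ne') (by rw [hG, hu] at hG0; exact hG0)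
  have hκ := hb.le_abs z _ (h.isPrincipalCurvature hzs hw0 hprin)
  simp only [Function.comp_apply, hz0] at hκ
  rw [abs_neg] at hκ
  have hle := sq_inner_add_sq_inner_le hb.norm_pole h.norm_lift.self_of_nhds
    h.norm_normal.self_of_nhds h.inner_lift.self_of_nhds
  have has := abs_le.1 (hb.abs_inner_lift_le h)
  have hsq : c ^ 2 ≤ (⟪η z, p⟫ / (1 + ⟪F z, p⟫)) ^ 2 := by
    rw [← sq_abs (⟪η z, p⟫ / (1 + ⟪F z, p⟫))]
    exact pow_le_pow_left₀ hb.pos.le hκ 2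
  rw [div_pow, le_div_iff₀ (by positivity)] at hsq
  -- `c² (1 + a)² ≤ b² ≤ (1 + a) (1 - a)` contradicts `(1 + s) < c² (1 - s)` and `|a| ≤ s`
  have h1 : c ^ 2 * (1 + ⟪F z, p⟫) ≤ 1 - ⟪F z, p⟫ := by
    refine le_of_mul_le_mul_right ?_ ha
    nlinarith
  have h2 : c ^ 2 * (1 - s) ≤ c ^ 2 * (1 + ⟪F z, p⟫) :=
    mul_le_mul_of_nonneg_left (by linarith) (sq_nonneg c)
  linarith [hb.lt_sq]

end TubeBound

end GaussSphere

/-! ### The highest point -/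

section Height

variable {m : ℕ}

/-- The sine of the distance of a point of projective space from the hyperplane `p^⊥`. -/
noncomputable def sinDist (p : Euc (m + 1)) : RP m → ℝ :=
  Projectivization.lift (fun v : {v : Euc (m + 1) // v ≠ 0} => |⟪v.1, p⟫| / ‖v.1‖) (by
    rintro ⟨a, ha⟩ ⟨b, hb⟩ t rfl
    have ht : t ≠ 0 := by
      rintro rfl
      simp at ha
    simp only [real_inner_smul_left, abs_mul, norm_smul, Real.norm_eq_abs]
    exact mul_div_mul_left _ _ (abs_ne_zero.2 ht))

theorem sinDist_mk (p v : Euc (m + 1)) (hv : v ≠ 0) :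
    sinDist p (Projectivization.mk ℝ v hv) = |⟪v, p⟫| / ‖v‖ := rfl

theorem continuous_sinDist (p : Euc (m + 1)) : Continuous (sinDist p) := by
  rw [RP.isQuotientMap_mk'.continuous_iff]
  change Continuous fun v : {v : Euc (m + 1) // v ≠ 0} => |⟪v.1, p⟫| / ‖v.1‖
  refine Continuous.div (by fun_prop) (by fun_prop) fun v => norm_ne_zero_iff.2 v.2

/-- A vector orthogonal to `p` makes an angle of at least the distance from `p^⊥` with any lift. -/
theorem abs_inner_le_sin_angle {p v w : Euc (m + 1)} (hp : ‖p‖ = 1) (hv : ‖v‖ = 1) (hw : w ≠ 0)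
    (hwp : ⟪w, p⟫ = 0) : |⟪v, p⟫| ≤ Real.sin (angle v w) := by
  have hwn : ‖w‖ ≠ 0 := norm_ne_zero_iff.2 hw
  have h1 : ⟪‖w‖⁻¹ • w, v⟫ ^ 2 + ⟪p, v⟫ ^ 2 ≤ 1 :=
    sq_inner_add_sq_inner_le hv (by rw [norm_smul, norm_inv, norm_norm, inv_mul_cancel₀ hwn]) hp
      (by rw [real_inner_smul_right, real_inner_comm, hwp, mul_zero])
  have h2 : Real.cos (angle v w) = ⟪‖w‖⁻¹ • w, v⟫ := by
    rw [cos_angle, hv, real_inner_smul_left, real_inner_comm]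
    field_simp
  have h3 := Real.sin_sq_add_cos_sq (angle v w)
  rw [h2] at h3
  refine abs_le_of_sq_le_sq ?_ (sin_angle_nonneg v w)
  rw [real_inner_comm p v]
  linarith

/-- Unit lifts of the points of the tube of radius `R` about the projective hyperplane `W` have
height at most `sin R`. -/
theorem abs_inner_le_sin_of_geodDistTo_le {W : Submodule ℝ (Euc (m + 1))} (hW : W ≠ ⊥)
    {p : Euc (m + 1)} (hp : ‖p‖ = 1) (hpW : ∀ w ∈ W, ⟪w, p⟫ = 0) {R : ℝ} (hR : 0 ≤ R)
    (hR' : R ≤ Real.pi / 2) {v : Euc (m + 1)} (hv : ‖v‖ = 1) (hv0 : v ≠ 0)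
    (hd : RP.geodDistTo (Projectivization.mk ℝ v hv0) (RP.subspace W) ≤ R) :
    |⟪v, p⟫| ≤ Real.sin R := by
  have hvp : |⟪v, p⟫| ≤ 1 := by
    have := abs_real_inner_le_norm v p
    rwa [hv, hp, mul_one] at this
  have hle : Real.arcsin |⟪v, p⟫| ≤ R := by
    refine le_trans ?_ hd
    refine le_csInf ?_ ?_
    · obtain ⟨w, hw, hw0⟩ := Submodule.exists_mem_ne_zero_of_ne_bot hW
      refine ⟨_, mem_image_of_mem _ (?_ : Projectivization.mk ℝ w hw0 ∈ RP.subspace W)⟩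
      rw [RP.subspace, mem_ofPred_eq, Projectivization.submodule_mk]
      exact (Submodule.span_singleton_le_iff_mem _ _).2 hw
    · rintro _ ⟨l, hl, rfl⟩
      induction l using Projectivization.ind with
      | h w hw0 =>
        rw [RP.subspace, mem_ofPred_eq, Projectivization.submodule_mk] at hl
        have hwp := hpW w ((Submodule.span_singleton_le_iff_mem _ _).1 hl)
        have h0 : 0 ≤ min (angle v w) (angle v (-w)) :=
          le_min (angle_nonneg _ _) (angle_nonneg _ _)
        have h1 : min (angle v w) (angle v (-w)) ≤ Real.pi / 2 := by
          rw [angle_neg_right]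
          rcases le_total (angle v w) (Real.pi / 2) with h | h
          · exact (min_le_left _ _).trans h
          · exact (min_le_right _ _).trans (by linarith)
        rw [RP.geodDist_mk, Real.arcsin_le_iff_le_sin
          ⟨by linarith [abs_nonneg ⟪v, p⟫], hvp⟩ ⟨by linarith [Real.pi_pos], h1⟩]
        rcases min_choice (angle v w) (angle v (-w)) with h | h <;> rw [h]
        · exact abs_inner_le_sin_angle hp hv hw0 hwp
        · exact abs_inner_le_sin_angle hp hv (neg_ne_zero.2 hw0)
            (by rw [inner_neg_left, hwp, neg_zero])
  rw [← Real.sin_arcsin (by linarith [abs_nonneg ⟪v, p⟫]) hvp]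
  exact Real.sin_le_sin_of_le_of_le_pi_div_two
    (by linarith [Real.arcsin_nonneg.2 (abs_nonneg ⟪v, p⟫), Real.pi_pos]) hR' hle

end Height

section Top

variable {n : ℕ} {M : Type*} [TopologicalSpace M] [ChartedSpace (Euc n) M]
  {f : M → RP (n + 1)} {p : Euc (n + 2)} {s c : ℝ}

namespace TubeBound

theorem sq_add_sq_eq_one {F η : M → Euc (n + 2)} {x : M} (hb : TubeBound f p s c)
    (hp : p = ⟪F x, p⟫ • F x + ⟪η x, p⟫ • η x) :
    ⟪F x, p⟫ ^ 2 + ⟪η x, p⟫ ^ 2 = 1 := by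
  have h1 : ⟪p, p⟫ = 1 := by rw [real_inner_self_eq_norm_sq, hb.norm_pole, one_pow]
  nth_rewrite 1 [hp] at h1
  rw [inner_add_left, real_inner_smul_left, real_inner_smul_left] at h1
  linarith

/-- At a point of largest distance from the hyperplane, `p` is orthogonal to the tangent space, and
all principal curvatures are at least `c` with respect to one of the two normals. -/
theorem exists_highest_point [IsManifold (𝓡 n) ∞ M] [CompactSpace M] [Nonempty M]
    (hb : TubeBound f p s c) (hn : n ≠ 0) (hf : IsSmoothImmersion f) :
    ∃ (x : M) (F η : M → Euc (n + 2)), IsLocalUnitNormal f x F η ∧ CurvatureGE c F η x ∧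
      p = ⟪F x, p⟫ • F x + ⟪η x, p⟫ • η x := by
  obtain ⟨x, -, hx⟩ := isCompact_univ.exists_isMaxOn univ_nonempty
    ((continuous_sinDist p).comp hf.1.continuous).continuousOn
  -- the signs are chosen so that `F` is above the hyperplane and `η` points back towards it
  obtain ⟨F, η, h, ha0, hb0⟩ : ∃ F η : M → Euc (n + 2), IsLocalUnitNormal f x F η ∧
      0 ≤ ⟪F x, p⟫ ∧ ⟪η x, p⟫ ≤ 0 := by
    obtain ⟨U, -, hxU, F, η, hUF⟩ := hf.exists_isLocalUnitNormal x
    have h := hUF x hxU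
    rcases le_total 0 ⟪F x, p⟫ with h1 | h1 <;> rcases le_total ⟪η x, p⟫ 0 with h2 | h2
    · exact ⟨F, η, h, h1, h2⟩
    · exact ⟨F, _, h.neg_normal, h1, by simpa [inner_neg_left] using h2⟩
    · exact ⟨_, η, h.neg_lift, by simpa [inner_neg_left] using h1, h2⟩
    · exact ⟨_, _, h.neg_lift.neg_normal, by simpa [inner_neg_left] using h1,
        by simpa [inner_neg_left] using h2⟩
  have hxs := mem_chart_source (Euc n) x
  have hz0 : (chartAt (Euc n) x).symm (chartAt (Euc n) x x) = x :=
    (chartAt (Euc n) x).left_inv hxs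
  have hval : ∀ y, ‖F y‖ = 1 → (∃ h : F y ≠ 0, Projectivization.mk ℝ (F y) h = f y) →
      sinDist p (f y) = |⟪F y, p⟫| := by
    rintro y hy ⟨hy0, hy1⟩
    rw [← hy1, sinDist_mk, hy, div_one]
  have hmax : IsLocalMax
      (fun u => ⟪(F ∘ (chartAt (Euc n) x).symm) u, p⟫) (chartAt (Euc n) x x) := by
    filter_upwards [(tendsto_chart_symm hxs).eventually h.norm_lift,
      (tendsto_chart_symm hxs).eventually h.mk_lift] with u h1 h2
    simp only [Function.comp_apply, hz0]
    have h3 := hx (mem_univ ((chartAt (Euc n) x).symm u))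
    simp only [Function.comp_apply, mem_ofPred_eq] at h3
    rw [hval _ h1 h2, hval x h.norm_lift.self_of_nhds h.mk_lift.self_of_nhds,
      abs_of_nonneg ha0] at h3
    exact (le_abs_self _).trans h3
  obtain ⟨hpe, hform⟩ := (h.isNormalPair hxs).of_isLocalMax
    (hf.injective_fderiv_chart h hxs) (by simp) hmax
  simp only [Function.comp_apply, hz0] at hpe hform
  have hab := sq_add_sq_eq_one hb hpe
  have has := (abs_le.1 (hb.abs_inner_lift_le h)).2
  have hbneg : ⟪η x, p⟫ < 0 := by
    refine lt_of_le_of_ne hb0 fun h0 => ?_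
    rw [h0] at hab
    nlinarith [hb.lt_one]
  refine ⟨x, F, η, h, h.curvatureGE_of_gap hn hf (hb.le_abs x)
    (τ := ⟪F x, p⟫ / -⟪η x, p⟫) ?_ ?_, hpe⟩
  · rw [div_lt_iff₀ (by linarith)]
    have h1 : ⟪F x, p⟫ ^ 2 < (c * -⟪η x, p⟫) ^ 2 := by
      have h2 : ⟪F x, p⟫ ^ 2 ≤ s ^ 2 := pow_le_pow_left₀ ha0 has 2
      have h3 : c ^ 2 * (1 - s) * (1 + s) ≤ c ^ 2 * ⟪η x, p⟫ ^ 2 := by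
        rw [mul_assoc]
        exact mul_le_mul_of_nonneg_left (by nlinarith) (sq_nonneg c)
      have h4 : (1 + s) * (1 + s) ≤ c ^ 2 * (1 - s) * (1 + s) :=
        mul_le_mul_of_nonneg_right hb.lt_sq.le (by linarith [hb.nonneg])
      nlinarith [hb.nonneg]
    exact lt_of_pow_lt_pow_left₀ 2 (by nlinarith [hb.pos]) h1
  · rw [h.curvatureGE_iff hxs]
    intro w
    have h1 := hform w
    rw [neg_mul, div_mul_eq_mul_div, ← div_neg, neg_neg, div_le_iff_of_neg hbneg]
    linarith

end TubeBound

end Top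

/-! ### The family of lifts with positive second fundamental form -/

section Lifts

variable {n : ℕ} {M : Type*} [TopologicalSpace M] [ChartedSpace (Euc n) M]
  {f : M → RP (n + 1)} {p : Euc (n + 2)} {s c : ℝ}

/-- The triples `(x, F x, η x)` of a point, a lift of its image to the sphere and a unit normal at
this lift for which all principal curvatures are at least `c`. -/
def positiveLifts (f : M → RP (n + 1)) (c : ℝ) : Set (M × (Euc (n + 2) × Euc (n + 2))) :=
  {a | ∃ F η : M → Euc (n + 2), IsLocalUnitNormal f a.1 F η ∧ CurvatureGE c F η a.1 ∧
    (F a.1, η a.1) = a.2}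

theorem mk_mem_positiveLifts {x : M} {F η : M → Euc (n + 2)} (h : IsLocalUnitNormal f x F η)
    (hc : CurvatureGE c F η x) : (x, (F x, η x)) ∈ positiveLifts f c :=
  ⟨F, η, h, hc, rfl⟩

theorem neg_mem_positiveLifts {x : M} {z : Euc (n + 2) × Euc (n + 2)}
    (h : (x, z) ∈ positiveLifts f c) : (x, -z) ∈ positiveLifts f c := by
  obtain ⟨F, η, h1, h2, h3⟩ := h
  exact ⟨-F, -η, h1.neg_lift.neg_normal, h2.neg_neg, congrArg Neg.neg h3⟩

/-- The second fundamental form cannot be positive definite for both unit normals. -/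
theorem CurvatureGE.not_neg_normal {F η : M → Euc (n + 2)} {x : M} (hn : n ≠ 0)
    (hf : IsSmoothImmersion f) (hc : 0 < c) (h : IsLocalUnitNormal f x F η)
    (h1 : CurvatureGE c F η x) : ¬CurvatureGE c F (-η) x := by
  intro h2
  have : NeZero n := ⟨hn⟩
  obtain ⟨v, hv⟩ : ∃ v : Euc n, v ≠ 0 := exists_ne 0
  have hv' := h1 v
  have hv'' := h2 v
  rw [mfderiv_neg] at hv''
  have h3 : c * norm (E := Euc (n + 2)) (mfderiv (𝓡 n) 𝓘(ℝ, Euc (n + 2)) F x v) ^ 2 ≤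
      - -inner (E := Euc (n + 2)) ℝ (mfderiv (𝓡 n) 𝓘(ℝ, Euc (n + 2)) η x v)
        (mfderiv (𝓡 n) 𝓘(ℝ, Euc (n + 2)) F x v) :=
    le_of_le_of_eq hv'' (congrArg Neg.neg (inner_neg_left (𝕜 := ℝ) (E := Euc (n + 2)) _ _))
  have h4 : 0 < norm (E := Euc (n + 2)) (mfderiv (𝓡 n) 𝓘(ℝ, Euc (n + 2)) F x v) := by
    refine norm_pos_iff.2 fun h0 => hv ?_
    exact hf.injective_mfderiv_lift h.mdifferentiableAt_lift h.mk_lift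
      (h0.trans (map_zero _).symm)
  have h5 := mul_pos hc (pow_pos h4 2)
  linarith

theorem mem_positiveLifts_iff [IsManifold (𝓡 n) ∞ M] (hn : n ≠ 0) (hf : IsSmoothImmersion f)
    (hc : 0 < c) {U : Set M} (hU : IsOpen U) {F η : M → Euc (n + 2)}
    (hUF : ∀ y ∈ U, IsLocalUnitNormal f y F η ∧ CurvatureGE c F η y) {y : M} (hy : y ∈ U)
    {z : Euc (n + 2) × Euc (n + 2)} :
    (y, z) ∈ positiveLifts f c ↔ z = (F y, η y) ∨ z = -(F y, η y) := by
  constructor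
  · rintro ⟨F', η', h1, h2, h0⟩
    dsimp only at h1 h2 h0
    rw [← h0]
    obtain ⟨h3, h4⟩ := IsLocalUnitNormal.eventually_eq_or_neg hf hU (fun z hz => (hUF z hz).1) hy h1
    have hn1 := h2.not_neg_normal hn hf hc h1
    have hpos := (hUF y hy).2
    rcases h3 with h3 | h3 <;> rcases h4 with h4 | h4
    · left
      rw [h3.self_of_nhds, h4.self_of_nhds]
    · exact absurd (hpos.congr h3 (by filter_upwards [h4] with t ht; simp [ht])) hn1
    · exact absurd (hpos.neg_neg.congr h3 (by filter_upwards [h4] with t ht; simp [ht])) hn1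
    · right
      rw [h3.self_of_nhds, h4.self_of_nhds]
      rfl
  · have h := mk_mem_positiveLifts (hUF y hy).1 (hUF y hy).2
    rintro (rfl | rfl)
    · exact h
    · exact neg_mem_positiveLifts h

theorem IsLocalUnitNormal.prodMk_ne_neg {F η : M → Euc (n + 2)} {y : M}
    (h : IsLocalUnitNormal f y F η) : (F y, η y) ≠ -(F y, η y) := by
  intro h0
  have h1 : F y = -F y := congrArg Prod.fst h0
  have h2 : (2 : ℝ) • F y = 0 := by rw [two_smul, ← eq_neg_iff_add_eq_zero, ← h1]
  exact h.mk_lift.self_of_nhds.1 ((smul_eq_zero.1 h2).resolve_left two_ne_zero)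

theorem IsLocalUnitNormal.continuousOn_prodMk {U : Set M} {F η : M → Euc (n + 2)}
    (hUF : ∀ y ∈ U, IsLocalUnitNormal f y F η) : ContinuousOn (fun y => (F y, η y)) U := fun y hy =>
  ((hUF y hy).contMDiffAt_lift.continuousAt.prodMk
    (hUF y hy).contMDiffAt_normal.continuousAt).continuousWithinAt

namespace TubeBound

variable [IsManifold (𝓡 n) ∞ M]

/-- Local sections of the family of lifts, through each of its points. -/
theorem exists_local_section [CompactSpace M] [ConnectedSpace M]
    (hb : TubeBound f p s c) (hn : n ≠ 0) (hf : IsSmoothImmersion f)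
    {a : M × (Euc (n + 2) × Euc (n + 2))} (ha : a ∈ positiveLifts f c) :
    ∃ U, IsOpen U ∧ a.1 ∈ U ∧ ∃ F η : M → Euc (n + 2), (F a.1, η a.1) = a.2 ∧
      ∀ y ∈ U, IsLocalUnitNormal f y F η ∧ CurvatureGE c F η y := by
  obtain ⟨x, z⟩ := a
  obtain ⟨x₀, F₀, η₀, h₀, hc₀, -⟩ := hb.exists_highest_point hn hf
  obtain ⟨U, hU, hxU, F, η, hUF⟩ :=
    exists_curvatureGE hn hf hb.pos hb.le_abs ⟨F₀, η₀, h₀, hc₀⟩ x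
  rcases (mem_positiveLifts_iff hn hf hb.pos hU hUF hxU).1 ha with h | h
  · exact ⟨U, hU, hxU, F, η, h.symm, hUF⟩
  · exact ⟨U, hU, hxU, -F, -η, h.symm, fun y hy =>
      ⟨(hUF y hy).1.neg_lift.neg_normal, (hUF y hy).2.neg_neg⟩⟩

theorem isTwoSheeted_positiveLifts [CompactSpace M] [ConnectedSpace M]
    (hb : TubeBound f p s c) (hn : n ≠ 0) (hf : IsSmoothImmersion f) :
    IsTwoSheeted (positiveLifts f c) := by
  intro x
  obtain ⟨x₀, F₀, η₀, h₀, hc₀, -⟩ := hb.exists_highest_point hn hf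
  obtain ⟨U, hU, hxU, F, η, hUF⟩ :=
    exists_curvatureGE hn hf hb.pos hb.le_abs ⟨F₀, η₀, h₀, hc₀⟩ x
  exact ⟨U, hU, hxU, fun y => (F y, η y),
    IsLocalUnitNormal.continuousOn_prodMk fun y hy => (hUF y hy).1, fun y hy =>
      ⟨(hUF y hy).1.prodMk_ne_neg, fun _ => mem_positiveLifts_iff hn hf hb.pos hU hUF hy⟩⟩

theorem compactSpace_positiveLifts [CompactSpace M] [ConnectedSpace M]
    (hb : TubeBound f p s c) (hn : n ≠ 0) (hf : IsSmoothImmersion f) :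
    CompactSpace (positiveLifts f c) := by
  rw [← isCompact_iff_compactSpace]
  refine IsCompact.of_isClosed_subset (isCompact_univ.prod
    ((isCompact_closedBall (0 : Euc (n + 2)) 1).prod (isCompact_closedBall (0 : Euc (n + 2)) 1)))
    (hb.isTwoSheeted_positiveLifts hn hf).isClosed ?_
  rintro ⟨x, z⟩ ⟨F, η, h, -, h0⟩
  dsimp only at h h0
  rw [← h0]
  refine ⟨mem_univ _, ?_, ?_⟩
  · exact mem_closedBall_zero_iff.2 h.norm_lift.self_of_nhds.le
  · exact mem_closedBall_zero_iff.2 h.norm_normal.self_of_nhds.le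

/-- Near a point of the family of lifts, the family is the graph of a local section. -/
theorem eventually_snd_eq_section [CompactSpace M] [ConnectedSpace M] (hb : TubeBound f p s c)
    (hn : n ≠ 0) (hf : IsSmoothImmersion f) {U : Set M} (hU : IsOpen U) {F η : M → Euc (n + 2)}
    (hUF : ∀ y ∈ U, IsLocalUnitNormal f y F η ∧ CurvatureGE c F η y) {a : positiveLifts f c}
    (haU : a.1.1 ∈ U) (ha : (F a.1.1, η a.1.1) = a.1.2) :
    ∀ᶠ b : positiveLifts f c in 𝓝 a, b.1.1 ∈ U ∧ b.1.2 = (F b.1.1, η b.1.1) :=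
  IsTwoSheeted.eventually_snd_eq hU
    (IsLocalUnitNormal.continuousOn_prodMk fun y hy => (hUF y hy).1)
    (fun y hy => ⟨(hUF y hy).1.prodMk_ne_neg,
      fun _ => mem_positiveLifts_iff hn hf hb.pos hU hUF hy⟩) haU ha.symm

variable {L : Euc (n + 2) →L[ℝ] Euc (n + 1)}

theorem isLocalHomeomorph_gaussSphere_positiveLifts [CompactSpace M] [ConnectedSpace M]
    (hb : TubeBound f p s c) (hn : n ≠ 0) (hf : IsSmoothImmersion f)
    (hL : ∀ z, ⟪z, p⟫ = 0 → ‖L z‖ = ‖z‖) :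
    IsLocalHomeomorph fun a : positiveLifts f c => gaussSphere p L a.1.2 := by
  refine IsLocalHomeomorph.mk _ fun a => ?_
  obtain ⟨U, hU, haU, F, η, hFa, hUF⟩ := hb.exists_local_section hn hf a.2
  obtain ⟨Φ, haΦ, hΦ⟩ :=
    hb.isLocalDiffeomorphAt_gaussSphere hL hU (fun y hy => (hUF y hy).1) haU
  obtain ⟨e, hae, he⟩ := (hb.isTwoSheeted_positiveLifts hn hf).isLocalHomeomorph_fst a
  obtain ⟨A, hAsub, hA, haA⟩ := eventually_nhds_iff.1
    (hb.eventually_snd_eq_section hn hf hU hUF haU hFa)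
  have hefst : ∀ b : positiveLifts f c, e b = b.1.1 := fun b => (congrFun he b).symm
  have hΦs : IsOpen Φ.source := Φ.open_source
  refine ⟨(e.trans Φ.toOpenPartialHomeomorph).restrOpen A hA, ?_, ?_⟩
  · rw [OpenPartialHomeomorph.restrOpen_source, OpenPartialHomeomorph.trans_source]
    refine ⟨⟨hae, ?_⟩, haA⟩
    rw [mem_preimage, hefst]
    exact haΦ
  · intro b hb'
    rw [OpenPartialHomeomorph.restrOpen_source, OpenPartialHomeomorph.trans_source] at hb'
    obtain ⟨⟨-, h1⟩, h2⟩ := hb'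
    rw [mem_preimage, hefst] at h1
    change gaussSphere p L b.1.2 = Φ (e b)
    rw [hefst, (hAsub b h2).2]
    exact hΦ h1

/-- The family of lifts is not connected: otherwise the Gauss map would be injective on it, but
it takes the same value at the two lifts of the highest point. -/
theorem not_preconnectedSpace_positiveLifts [T2Space M] [CompactSpace M] [ConnectedSpace M]
    (hb : TubeBound f p s c) (hn : 2 ≤ n) (hf : IsSmoothImmersion f)
    (hL : ∀ z, ⟪z, p⟫ = 0 → ‖L z‖ = ‖z‖) : ¬PreconnectedSpace (positiveLifts f c) := by
  intro hconn
  have hn0 : n ≠ 0 := by omega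
  have := hb.compactSpace_positiveLifts hn0 hf
  have hinj := (hb.isLocalHomeomorph_gaussSphere_positiveLifts hn0 hf hL).injective_of_sphere
    (by simp; omega)
  obtain ⟨x, F, η, h, hc, hp⟩ := hb.exists_highest_point hn0 hf
  have hmem := mk_mem_positiveLifts h hc
  have h1 : gaussSphere p L (-(F x, η x)) = gaussSphere p L (F x, η x) := by
    simp only [gaussSphere, gaussVec_neg hp (hb.sq_add_sq_eq_one hp) (hb.one_add_pos h).ne'
      (hb.one_sub_pos h).ne']
  have h2 := @hinj ⟨_, neg_mem_positiveLifts hmem⟩ ⟨_, hmem⟩ h1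
  exact h.prodMk_ne_neg (congrArg (fun a : positiveLifts f c => a.1.2) h2).symm

/-- The hypersurface lifts globally to the sphere and the lift has a global unit normal: as the
family of lifts is disconnected, it has a global section. -/
theorem exists_global_lift [T2Space M] [CompactSpace M] [ConnectedSpace M]
    (hb : TubeBound f p s c) (hn : 2 ≤ n) (hf : IsSmoothImmersion f)
    (hL : ∀ z, ⟪z, p⟫ = 0 → ‖L z‖ = ‖z‖) :
    ∃ F η : M → Euc (n + 2), ∀ x, IsLocalUnitNormal f x F η := by
  have hn0 : n ≠ 0 := by omega
  have := hb.compactSpace_positiveLifts hn0 hf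
  obtain ⟨σ, hσ, hσX⟩ := (hb.isTwoSheeted_positiveLifts hn0 hf).preconnectedSpace_or_exists_section
    |>.resolve_left (hb.not_preconnectedSpace_positiveLifts hn hf hL)
  refine ⟨fun x => (σ x).1, fun x => (σ x).2, fun x => ?_⟩
  obtain ⟨U, hU, hxU, F, η, hFx, hUF⟩ := hb.exists_local_section hn0 hf (hσX x)
  have hcont : Continuous fun y => (⟨(y, σ y), hσX y⟩ : positiveLifts f c) :=
    (continuous_id.prodMk hσ).subtype_mk _
  have hev := (hcont.tendsto x).eventually
    (hb.eventually_snd_eq_section hn0 hf hU hUF hxU hFx)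
  refine (hUF x hxU).1.congr ?_ ?_
  · filter_upwards [hev] with y hy using congrArg Prod.fst hy.2
  · filter_upwards [hev] with y hy using congrArg Prod.snd hy.2

/-- The Gauss map of the global lift is a diffeomorphism. -/
theorem nonempty_diffeomorph_sphere [T2Space M] [CompactSpace M] [ConnectedSpace M]
    (hb : TubeBound f p s c) (hn : 2 ≤ n) (hf : IsSmoothImmersion f) :
    Nonempty (M ≃ₘ^∞⟮𝓡 n, 𝓡 n⟯ Sph n) := by
  have hp0 : p ≠ 0 := norm_ne_zero_iff.1 (by rw [hb.norm_pole]; exact one_ne_zero)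
  obtain ⟨L, hL⟩ := exists_isometry_orthogonal hp0
  obtain ⟨F, η, h⟩ := hb.exists_global_lift hn hf hL
  have hdiff : IsLocalDiffeomorph (𝓡 n) (𝓡 n) ∞ fun x => gaussSphere p L (F x, η x) := fun x =>
    hb.isLocalDiffeomorphAt_gaussSphere hL isOpen_univ (fun y _ => h y) (mem_univ x)
  have hloc := hdiff.isLocalHomeomorph
  have hinj := hloc.injective_of_sphere (by simp; omega)
  have : PreconnectedSpace (Sph n) := isPreconnected_iff_preconnectedSpace.1
    (isPreconnected_sphere (by rw [← finrank_eq_rank, finrank_euclideanSpace_fin]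
                               exact_mod_cast (by omega : 1 < n + 1)) _ _)
  have hsurj : Function.Surjective fun x => gaussSphere p L (F x, η x) := by
    rw [← range_eq_univ]
    exact IsClopen.eq_univ ⟨(isCompact_range hloc.continuous).isClosed, hloc.isOpenMap.isOpen_range⟩
      (range_nonempty _)
  exact ⟨hdiff.diffeomorphOfBijective ⟨hinj, hsurj⟩⟩

end TubeBound

end Lifts

/-- The bound `tan ((π / 2 + R) / 2)` is `√((1 + sin R) / (1 - sin R))`. -/
theorem one_add_sin_lt_of_tan_lt {R c : ℝ} (hR : R ∈ Ioo 0 (Real.pi / 2))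
    (hc : Real.tan ((Real.pi / 2 + R) / 2) < c) :
    0 < c ∧ 1 + Real.sin R < c ^ 2 * (1 - Real.sin R) := by
  obtain ⟨t, ht⟩ : ∃ t, t = (Real.pi / 2 + R) / 2 := ⟨_, rfl⟩
  rw [← ht] at hc
  have ht0 : 0 < t := by linarith [hR.1, Real.pi_pos]
  have ht1 : t < Real.pi / 2 := by linarith [hR.2]
  have hcos : 0 < Real.cos t := Real.cos_pos_of_mem_Ioo ⟨by linarith, ht1⟩
  have htan : 0 < Real.tan t := Real.tan_pos_of_pos_of_lt_pi_div_two ht0 ht1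
  have h1 : Real.sin R = 1 - 2 * Real.cos t ^ 2 := by
    have h2 : Real.cos (2 * t) = -Real.sin R := by
      rw [← Real.cos_add_pi_div_two]
      congr 1
      linarith
    have h3 := Real.cos_two_mul t
    linarith
  refine ⟨htan.trans hc, ?_⟩
  have h4 : Real.sin t < c * Real.cos t := by
    rw [Real.tan_eq_sin_div_cos, div_lt_iff₀ hcos] at hc
    exact hc
  have h5 := pow_lt_pow_left₀ h4
    (Real.sin_nonneg_of_nonneg_of_le_pi ht0.le (by linarith)) two_ne_zero
  have h6 := Real.sin_sq_add_cos_sq t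
  rw [h1]
  nlinarith

theorem mainTheorem3 (n : ℕ) (hn : 2 ≤ n)
    {M : Type*} [TopologicalSpace M] [T2Space M] [CompactSpace M] [ConnectedSpace M]
    [ChartedSpace (Euc n) M] [IsManifold (𝓡 n) ∞ M]
    (f : M → RP (n + 1)) (hf : IsSmoothImmersion f)
    (W : Submodule ℝ (Euc (n + 2))) (hW : finrank ℝ W = n + 1)
    (R : ℝ) (hR : R ∈ Ioo 0 (Real.pi / 2))
    (hdist : ∀ x, RP.geodDistTo (f x) (RP.subspace W) ≤ R)
    -- the infimum of `|κ|`, over all points and all principal curvatures, exceeds the bound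
    (hcurv : ∃ c : ℝ, Real.tan ((Real.pi / 2 + R) / 2) < c ∧
      ∀ (x : M) (κ : ℝ), IsPrincipalCurvature f x κ → c ≤ |κ|) :
    Nonempty (M ≃ₘ^∞⟮𝓡 n, 𝓡 n⟯ Sph n) ∨ Nonempty (M ≃ₘ^∞⟮𝓡 n, 𝓡 n⟯ RP n) := by
  left
  obtain ⟨c, hc, hcurv⟩ := hcurv
  obtain ⟨hc0, hcR⟩ := one_add_sin_lt_of_tan_lt hR hc
  obtain ⟨p, hpW, hp⟩ : ∃ p ∈ Wᗮ, ‖p‖ = 1 := by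
    have h1 := W.finrank_add_finrank_orthogonal
    rw [hW, finrank_euclideanSpace_fin] at h1
    have : Nontrivial Wᗮ := nontrivial_of_finrank_pos (R := ℝ) (by omega)
    obtain ⟨q, hq⟩ := exists_norm_eq Wᗮ zero_le_one
    exact ⟨q, q.2, hq⟩
  have hW0 : W ≠ ⊥ := by
    rintro rfl
    simp at hW
  have hsin : Real.sin R < 1 := by
    rw [← Real.sin_pi_div_two]
    exact Real.sin_lt_sin_of_lt_of_le_pi_div_two (by linarith [hR.1, Real.pi_pos]) le_rfl hR.2
  have hb : TubeBound f p (Real.sin R) c :=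
    { norm_pole := hp
      nonneg := Real.sin_nonneg_of_nonneg_of_le_pi hR.1.le (by linarith [hR.2, Real.pi_pos])
      lt_one := hsin
      abs_inner_le := fun x v hv hvx => by
        obtain ⟨hv0, hvx⟩ := hvx
        refine abs_inner_le_sin_of_geodDistTo_le hW0 hp
          (fun w hw => (Submodule.mem_orthogonal W p).1 hpW w hw) hR.1.le hR.2.le hv hv0 ?_
        rw [hvx]
        exact hdist x
      pos := hc0
      lt_sq := hcR
      le_abs := hcurv }
  exact hb.nonempty_diffeomorph_sphere hn hf
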